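/- A polygon is a possibly unbounded set $P\subseteq\mathbb{R}^2$ that is an intersection of finitely many closed half-planes and has non-empty interior; its edges are its one-dimensional faces. For positive integers $m,k$ let $N(m,k)$ (respectively $\overline{N}(m,k)$) denote the minimal $n$ such that for every polygon $P$ with exactly $m$ edges there exist real polynomials $p_1,\dots,p_n$ in two variables such that (i) $\operatorname{int}P=\{x\in\mathbb{R}^2: p_1(x)>0,\dots,p_n(x)>0\}$ (respectively $P=\{x\in\mathbb{R}^2: p_1(x)\ge 0,\dots,p_n(x)\ge 0\}$), and (ii) every $p_i$ is a product of at most $k$ affine functions, each of which is non-negative on $P$ and vanishes on some edge of $P$. Put $s(m,k):=\max\{m/k,\log_2 m\}$. Then both minima exist, and for all $m,k\ge 1$ $$s(m,k)\le N(m,k)\le\overline{N}(m,k).$$ Moreover, there is a sequence $(\varepsilon_m)$ of real numbers, depending only on $m$, with $\varepsilon_m\to 0$ as $m\to\infty$, such that for all $m\ge 2$ and all $k\ge 1$ $$\overline{N}(m,k)\le(1+\varepsilon_m)\,s(m,k).$$ -/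

import Mathlib

open Filter Topology

namespace PolygonRep

/-- The real plane `ℝ²`. Only its affine structure and its (product) topology are used. -/
abbrev Plane : Type := Fin 2 → ℝ

/-- Closed half-planes `{x | f x ≤ c}` with `f` a non-zero linear functional. -/
def IsClosedHalfPlane (H : Set Plane) : Prop :=
  ∃ (f : Plane →ₗ[ℝ] ℝ) (c : ℝ), f ≠ 0 ∧ H = {x | f x ≤ c}

/-- A polygon is a (possibly unbounded) two-dimensional convex polyhedron: an intersection of
finitely many closed half-planes that has non-empty interior. -/
def IsPolygon (P : Set Plane) : Prop :=
  (∃ 𝓗 : Set (Set Plane), 𝓗.Finite ∧ (∀ H ∈ 𝓗, IsClosedHalfPlane H) ∧ P = ⋂₀ 𝓗) ∧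
    (interior P).Nonempty

/-- An edge of `P` is a one-dimensional face of `P`, a face being the set of points of `P` at which
some linear functional attains its maximum over `P`. An edge may be a segment, a ray or a line. -/
def IsEdge (P I : Set Plane) : Prop :=
  IsExposed ℝ P I ∧ Module.finrank ℝ (vectorSpan ℝ I) = 1

/-- `P` is a polygon with exactly `m` edges. -/
def IsPolygonWithEdges (m : ℕ) (P : Set Plane) : Prop :=
  IsPolygon P ∧ {I : Set Plane | IsEdge P I}.encard = m

/-- `p` is a product of at most `k` affine functions (polynomials of degree at most one, repetitions
allowed), each of them non-negative on `P` and vanishing on some edge of `P`. -/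
def IsEdgeProduct (k : ℕ) (P : Set Plane) (p : MvPolynomial (Fin 2) ℝ) : Prop :=
  ∃ L : Multiset (MvPolynomial (Fin 2) ℝ), L.card ≤ k ∧ p = L.prod ∧
    ∀ a ∈ L, a.totalDegree ≤ 1 ∧ (∀ x ∈ P, 0 ≤ MvPolynomial.eval x a) ∧
      ∃ I, IsEdge P I ∧ ∀ x ∈ I, MvPolynomial.eval x a = 0

/-- The numbers `n` such that the interior of every polygon `P` with `m` edges can be written as
`{p₁ > 0, …, pₙ > 0}` with every `pᵢ` a product as in `IsEdgeProduct k P`. -/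
def openCounts (m k : ℕ) : Set ℕ :=
  {n | ∀ P : Set Plane, IsPolygonWithEdges m P →
    ∃ p : Fin n → MvPolynomial (Fin 2) ℝ,
      interior P = {x | ∀ i, 0 < MvPolynomial.eval x (p i)} ∧ ∀ i, IsEdgeProduct k P (p i)}

/-- The numbers `n` such that every polygon `P` with `m` edges can be written as
`{p₁ ≥ 0, …, pₙ ≥ 0}` with every `pᵢ` a product as in `IsEdgeProduct k P`. -/
def closedCounts (m k : ℕ) : Set ℕ :=
  {n | ∀ P : Set Plane, IsPolygonWithEdges m P →
    ∃ p : Fin n → MvPolynomial (Fin 2) ℝ,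
      P = {x | ∀ i, 0 ≤ MvPolynomial.eval x (p i)} ∧ ∀ i, IsEdgeProduct k P (p i)}

/-- `N(m, k)`, the least element of `openCounts m k`. -/
noncomputable def openN (m k : ℕ) : ℕ := sInf (openCounts m k)

/-- `N̄(m, k)`, the least element of `closedCounts m k`. -/
noncomputable def closedN (m k : ℕ) : ℕ := sInf (closedCounts m k)

/-- `s(m, k) = max {m / k, log₂ m}`. -/
noncomputable def s (m k : ℕ) : ℝ := max ((m : ℝ) / (k : ℝ)) (Real.logb 2 (m : ℝ))

end PolygonRep

/-!
Write `l₁, …, lₘ` for the affine functions that define the edges of a polygon `P`. Every admissible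
factor is a non-negative multiple of some `lⱼ`, so a representation amounts to choosing which edges
enter which products.

**Lower bound.** A point in the relative interior of an edge must be excluded by a product containing
that edge, hence `m ≤ n k`. For the polygon bounded by `m` tangents of a parabola, every block of
consecutive tangents consists of exactly the constraints violated at some point. Hence the sign
vectors of the products at the points violating exactly the first `t` constraints, `0 ≤ t ≤ m`,
are pairwise distinct, and `m + 1 ≤ 2 ^ n` (`succ_le_two_pow_of_mem_openCounts`).

**Upper bound.** Order all edges but one by the angles of their normals, starting from the exceptional
edge. At a point on the inner side of the exceptional line, the violated constraints are consecutive,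
and tight ones occur only next to them (`IsFacetSystem.exists_order`). Give each edge a letter, let
the products collect the edges with equal letters, and take the exceptional edge as one more product.
This represents `P` as soon as every non-empty block of the resulting word has a letter of odd
multiplicity (`succ_mem_closedCounts`), that is, as soon as the word is the sequence of directions of
a path in the hypercube without repeated vertices. So one needs such paths of length `m - 1` in the
cube of dimension `n` which use each direction at most `k` times.

Such words can be joined by separators from a Gray code on a few further letters, which record which
of the words is being read (`exists_selfAvoiding_join`). If `k < √m`, join `k` copies of
`0 1 ⋯ N-1` with `N = ⌈m / k⌉`, at the cost of about `log₂ k` separator letters. If `k ≥ √m`, take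
`N` about `max (m / k) (log₂ m)` and join `N` Gray codes of length at most `k` in the `N`-dimensional
cube, whose directions are shifted cyclically from one to the next; then every direction is used
equally often, and about `log₂ N` separator letters suffice. In both cases their number is
negligible compared with `s m k`.
-/

namespace PolygonRep

/-! ### Self-avoiding words -/

/-- A word in which every non-empty block has a letter of odd multiplicity. Reading a letter as the
direction of an edge of the hypercube, these are the words of the paths without repeated vertex. -/
def SelfAvoiding (L : List ℕ) : Prop :=
  ∀ I : List ℕ, I <:+: L → I ≠ [] → ∃ a, Odd (I.count a)

namespace SelfAvoiding

lemma block {L L' : List ℕ} (h : SelfAvoiding L) (h' : L' <:+: L) : SelfAvoiding L' :=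
  fun I hI h0 => h I (hI.trans h') h0

lemma of_nodup {L : List ℕ} (h : L.Nodup) : SelfAvoiding L := by
  intro I hI h0
  obtain ⟨a, ha⟩ := List.exists_mem_of_ne_nil I h0
  refine ⟨a, ?_⟩
  rw [List.count_eq_one_of_mem (hI.sublist.nodup h) ha]
  exact odd_one

lemma map {L : List ℕ} (h : SelfAvoiding L) {g : ℕ → ℕ}
    (hg : ∀ a ∈ L, ∀ b ∈ L, g a = g b → a = b) : SelfAvoiding (L.map g) := by
  intro I hI h0
  obtain ⟨J, hJ, rfl⟩ := List.infix_map_iff.1 hI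
  obtain ⟨a, ha⟩ := h J hJ (by rintro rfl; simp at h0)
  refine ⟨g a, ?_⟩
  have haJ : a ∈ J := List.count_pos_iff.1 ha.pos
  have : (J.map g).count (g a) = J.count a := by
    rw [List.count, List.countP_map, List.count]
    apply List.countP_congr
    intro b hb
    simp only [Function.comp, beq_iff_eq]
    exact ⟨fun e => hg b (hJ.subset hb) a (hJ.subset haJ) e, fun e => by rw [e]⟩
  rwa [this]

end SelfAvoiding

lemma isInfix_of_isInfix_append_cons {α : Type*} {I A B : List α} {c : α}
    (h : I <:+: A ++ c :: B) (hc : c ∉ I) : I <:+: A ∨ I <:+: B := by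
  obtain ⟨s, t, h⟩ := h
  rw [List.append_assoc, List.append_eq_append_iff] at h
  rcases h with ⟨a', rfl, h⟩ | ⟨c', rfl, h⟩
  · rw [List.append_eq_append_iff] at h
    rcases h with ⟨b', rfl, _⟩ | ⟨b', rfl, h⟩
    · exact Or.inl ⟨s, b', by simp⟩
    · cases b' with
      | nil => exact Or.inl ⟨s, [], by simp⟩
      | cons d b' =>
        simp only [List.cons_append, List.cons.injEq] at h
        exact absurd (by simp [h.1]) hc
  · cases c' with
    | nil =>
      cases I with
      | nil => exact Or.inl ⟨[], A, by simp⟩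
      | cons d I =>
        simp only [List.nil_append, List.cons_append, List.cons.injEq] at h
        exact absurd (by simp [h.1]) hc
    | cons d c' =>
      simp only [List.cons_append, List.cons.injEq] at h
      exact Or.inr ⟨c', t, by rw [h.2]; simp⟩

/-- Self-avoiding words over small letters, separated by the letters of a self-avoiding word over
large letters, form a self-avoiding word: a block that meets a separator is seen by the large
letters, any other block lies inside one of the small words. -/
lemma SelfAvoiding.separate {N : ℕ} {h₀ : List ℕ} {ps : List (ℕ × List ℕ)}
    (h₀_lt : ∀ a ∈ h₀, a < N) (h₀_av : SelfAvoiding h₀)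
    (ps_le : ∀ p ∈ ps, N ≤ p.1) (ps_lt : ∀ p ∈ ps, ∀ a ∈ p.2, a < N)
    (ps_av : ∀ p ∈ ps, SelfAvoiding p.2) (hps : SelfAvoiding (ps.map Prod.fst)) :
    SelfAvoiding (h₀ ++ ps.flatMap fun p => p.1 :: p.2) := by
  have hfilter : (h₀ ++ ps.flatMap fun p => p.1 :: p.2).filter (fun a => decide (N ≤ a))
      = ps.map Prod.fst := by
    rw [List.filter_append, List.filter_eq_nil_iff.2 (by simpa using h₀_lt), List.nil_append]
    clear hps
    induction ps with
    | nil => rfl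
    | cons p ps ih =>
      have h1 : p.2.filter (fun a => decide (N ≤ a)) = [] :=
        List.filter_eq_nil_iff.2 (by simpa using ps_lt p (by simp))
      rw [List.flatMap_cons, List.filter_append, ih (fun q hq => ps_le q (by simp [hq]))
        (fun q hq => ps_lt q (by simp [hq])) (fun q hq => ps_av q (by simp [hq])),
        List.filter_cons_of_pos (by simpa using ps_le p (by simp)), h1]
      rfl
  intro I hI hI0
  by_cases hF : I.filter (fun a => decide (N ≤ a)) = []
  · have hlt : ∀ a ∈ I, a < N := by simpa [List.filter_eq_nil_iff] using hF
    clear hF hfilter hps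
    induction ps generalizing h₀ with
    | nil => exact h₀_av I (by simpa using hI) hI0
    | cons p ps ih =>
      rw [List.flatMap_cons, List.cons_append] at hI
      rcases isInfix_of_isInfix_append_cons hI
        (fun hp => absurd (hlt _ hp) (not_lt.2 (ps_le p (by simp)))) with h | h
      · exact h₀_av I h hI0
      · exact ih (ps_lt p (by simp)) (ps_av p (by simp)) (fun q hq => ps_le q (by simp [hq]))
          (fun q hq => ps_lt q (by simp [hq])) (fun q hq => ps_av q (by simp [hq])) h
  · obtain ⟨a, ha⟩ := hps _ (hfilter ▸ hI.filter _) hF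
    have haN : N ≤ a := by
      have := List.mem_filter.1 (List.count_pos_iff.1 ha.pos)
      simpa using this.2
    refine ⟨a, ?_⟩
    rwa [List.count_filter (by simpa using haN)] at ha

/-- The ruler word `0 1 0 2 0 1 0 ⋯`, the transition sequence of the binary Gray code. -/
def ruler : ℕ → List ℕ
  | 0 => []
  | n + 1 => ruler n ++ n :: ruler n

lemma length_ruler (n : ℕ) : (ruler n).length = 2 ^ n - 1 := by
  induction n with
  | zero => rfl
  | succ n ih =>
    have := Nat.one_le_two_pow (n := n)
    simp only [ruler, List.length_append, List.length_cons, ih, pow_succ]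
    omega

lemma lt_of_mem_ruler {n a : ℕ} (h : a ∈ ruler n) : a < n := by
  induction n with
  | zero => simp [ruler] at h
  | succ n ih =>
    simp only [ruler, List.mem_append, List.mem_cons] at h
    rcases h with h | h | h
    · exact (ih h).trans n.lt_succ_self
    · omega
    · exact (ih h).trans n.lt_succ_self

lemma selfAvoiding_ruler (n : ℕ) : SelfAvoiding (ruler n) := by
  induction n with
  | zero => exact SelfAvoiding.of_nodup List.nodup_nil
  | succ n ih =>
    have := SelfAvoiding.separate (N := n) (h₀ := ruler n) (ps := [(n, ruler n)])
      (fun a => lt_of_mem_ruler) ih (by simp) (by simpa using fun a => lt_of_mem_ruler)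
      (by simpa using ih) (SelfAvoiding.of_nodup (by simp))
    simpa [ruler] using this

/-- Words `h 0, …, h T` over the letters below `N` can be joined into one self-avoiding word by
separators from a ruler word on `w` new letters, provided that `T < 2 ^ w`. -/
lemma exists_selfAvoiding_join {N T w : ℕ} (hT : T < 2 ^ w) (h : ℕ → List ℕ)
    (h_lt : ∀ d, ∀ a ∈ h d, a < N) (h_av : ∀ d, SelfAvoiding (h d)) :
    ∃ L : List ℕ, SelfAvoiding L ∧ (∀ a ∈ L, a < N + w) ∧
      (∀ a < N, L.count a = ∑ d ∈ Finset.range (T + 1), (h d).count a) ∧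
      (∀ a, N ≤ a → L.count a ≤ T) ∧
      ∑ d ∈ Finset.range (T + 1), (h d).length ≤ L.length := by
  have hTl : T ≤ (ruler w).length := by rw [length_ruler]; omega
  set g : ℕ → ℕ := fun d => N + (ruler w).getD d 0 with hg
  have hgw : ∀ d < T, g d < N + w := by
    intro d hd
    have hd' : d < (ruler w).length := hd.trans_le hTl
    simp only [hg, List.getD_eq_getElem _ _ hd']
    exact Nat.add_lt_add_left (lt_of_mem_ruler (List.getElem_mem hd')) N
  set ps : List (ℕ × List ℕ) := (List.range T).map fun d => (g d, h (d + 1)) with hps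
  have hfst : ps.map Prod.fst = ((ruler w).take T).map (N + ·) := by
    apply List.ext_getElem
    · simp [hps, hTl]
    · intro i h1 h2
      simp only [hps, List.length_map, List.length_range] at h1
      simp [hps, hg, List.getElem?_eq_getElem (h1.trans_le hTl)]
  have hflat : ps.flatMap (fun p => p.1 :: p.2)
      = (List.range T).flatMap fun d => g d :: h (d + 1) := by
    rw [hps, List.flatMap_map]
  have hcount : ∀ a, (h 0 ++ (List.range T).flatMap fun d => g d :: h (d + 1)).count a
      = (∑ d ∈ Finset.range (T + 1), (h d).count a)
        + ((Finset.range T).filter fun d => g d = a).card := by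
    intro a
    clear hfst hflat hps hT hTl hgw
    induction T with
    | zero => simp
    | succ T ih =>
      rw [List.range_succ, List.flatMap_append, ← List.append_assoc, List.count_append, ih,
        Finset.sum_range_succ _ (T + 1), Finset.range_add_one (n := T), Finset.filter_insert]
      by_cases hga : g T = a
      · simp [hga]
        omega
      · simp [hga]
        omega
  refine ⟨h 0 ++ (List.range T).flatMap fun d => g d :: h (d + 1), ?_, ?_, ?_, ?_, ?_⟩
  · rw [← hflat]
    refine SelfAvoiding.separate (N := N) (h_lt 0) (h_av 0) ?_ ?_ ?_ ?_
    · simp [hps, hg]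
    · simpa [hps] using fun d _ => h_lt (d + 1)
    · simpa [hps] using fun d _ => h_av (d + 1)
    · rw [hfst]
      exact ((selfAvoiding_ruler w).block (List.take_prefix T _).isInfix).map
        fun a _ b _ hab => Nat.add_left_cancel hab
  · intro a ha
    simp only [List.mem_append, List.mem_flatMap, List.mem_range, List.mem_cons] at ha
    rcases ha with ha | ⟨d, hd, rfl | ha⟩
    · exact (h_lt 0 a ha).trans_le (Nat.le_add_right N w)
    · exact hgw d hd
    · exact (h_lt _ a ha).trans_le (Nat.le_add_right N w)
  · intro a ha
    rw [hcount, Finset.filter_false_of_mem (fun d _ hd => by simp only [hg] at hd; omega)]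
    simp
  · intro a ha
    rw [hcount, Finset.sum_eq_zero, zero_add]
    · exact (Finset.card_filter_le _ _).trans (by simp)
    · exact fun d _ => List.count_eq_zero.2 fun hd => absurd (h_lt d a hd) (not_lt.2 ha)
  · clear hcount hfst hflat hps hT hTl hgw
    induction T with
    | zero => simp
    | succ T ih =>
      rw [List.range_succ, List.flatMap_append, ← List.append_assoc, List.length_append,
        Finset.sum_range_succ]
      simp only [List.flatMap_cons, List.flatMap_nil, List.length_append, List.length_cons,
        List.length_nil] at ih ⊢
      omega

/-- `M` edges can be coded by a self-avoiding word on `n` letters in which no letter occurs more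
than `k` times. -/
def HasBalancedWord (M n k : ℕ) : Prop :=
  ∃ L : List ℕ, L.length = M ∧ SelfAvoiding L ∧ (∀ a ∈ L, a < n) ∧ ∀ a, L.count a ≤ k

lemma HasBalancedWord.of_length_le {M n k : ℕ} {L : List ℕ} (hM : M ≤ L.length)
    (h_av : SelfAvoiding L) (h_lt : ∀ a ∈ L, a < n) (h_count : ∀ a, L.count a ≤ k) :
    HasBalancedWord M n k :=
  ⟨L.take M, by simpa using hM, h_av.block (List.take_prefix M L).isInfix,
    fun a ha => h_lt a (List.mem_of_mem_take ha),
    fun a => ((List.take_sublist M L).count_le a).trans (h_count a)⟩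

lemma hasBalancedWord_self (M : ℕ) {k : ℕ} (hk : 1 ≤ k) : HasBalancedWord M M k :=
  ⟨List.range M, by simp, SelfAvoiding.of_nodup List.nodup_range, by simp,
    fun a => (List.nodup_iff_count_le_one.1 List.nodup_range a).trans hk⟩

/-- `k` passes through the alphabet, numbered by a Gray code on `w` further letters. -/
lemma hasBalancedWord_passes {M N k w : ℕ} (hk : 1 ≤ k) (hM : M ≤ k * N) (hw : k ≤ 2 ^ w) :
    HasBalancedWord M (N + w) k := by
  obtain ⟨T, rfl⟩ : ∃ T, k = T + 1 := ⟨k - 1, by omega⟩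
  obtain ⟨L, h_av, h_lt, h_small, h_large, h_len⟩ :=
    exists_selfAvoiding_join (N := N) (T := T) (w := w) (by omega) (fun _ => List.range N)
      (by simp) (fun _ => SelfAvoiding.of_nodup List.nodup_range)
  refine HasBalancedWord.of_length_le (hM.trans ?_) h_av h_lt fun a => ?_
  · simpa using h_len
  · rcases lt_or_ge a N with ha | ha
    · rw [h_small a ha, Finset.sum_const, Finset.card_range, smul_eq_mul]
      have := List.nodup_iff_count_le_one.1 (List.nodup_range (n := N)) a
      nlinarith
    · exact (h_large a ha).trans T.le_succ

lemma sum_count_rotations {N a : ℕ} {g : List ℕ} (hg : ∀ b ∈ g, b < N) (ha : a < N) :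
    ∑ d ∈ Finset.range N, (g.map fun b => (b + d) % N).count a = g.length := by
  induction g with
  | nil => simp
  | cons b g ih =>
    have hb : b < N := hg b (by simp)
    have hsum : ∑ d ∈ Finset.range N, (if (b + d) % N = a then 1 else 0) = 1 := by
      rw [Finset.sum_eq_single ((a + (N - b)) % N)]
      · rw [if_pos]
        rw [Nat.add_mod_mod, show b + (a + (N - b)) = a + N by omega, Nat.add_mod_right,
          Nat.mod_eq_of_lt ha]
      · intro d hd hne
        rw [if_neg]
        rintro rfl
        apply hne
        rw [Nat.mod_add_mod, show b + d + (N - b) = d + N by omega, Nat.add_mod_right,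
          Nat.mod_eq_of_lt (Finset.mem_range.1 hd)]
      · exact fun h => absurd (Finset.mem_range.2 (Nat.mod_lt _ (by omega))) h
    simp only [List.map_cons, List.count_cons, Finset.sum_add_distrib, beq_iff_eq,
      List.length_cons, hsum, ih fun c hc => hg c (List.mem_cons_of_mem b hc)]

/-- The same Gray code of length `K` is run through `N` times, with its directions shifted
cyclically each time, so that in the end all `N` directions have been used equally often. The runs
are numbered by a Gray code on `w` further letters. -/
lemma hasBalancedWord_rotations {M N k K w : ℕ} (hN : 1 ≤ N) (hK : K < 2 ^ N) (hKk : K ≤ k)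
    (hNk : N ≤ k + 1) (hM : M ≤ N * K) (hw : N ≤ 2 ^ w) : HasBalancedWord M (N + w) k := by
  obtain ⟨T, rfl⟩ : ∃ T, N = T + 1 := ⟨N - 1, by omega⟩
  set N := T + 1
  set g : List ℕ := (ruler N).take K with hg
  have hg_len : g.length = K := by
    rw [hg, List.length_take, length_ruler]
    omega
  have hg_lt : ∀ a ∈ g, a < N := fun a ha => lt_of_mem_ruler (List.mem_of_mem_take ha)
  have hg_av : SelfAvoiding g := (selfAvoiding_ruler N).block (List.take_prefix K _).isInfix
  obtain ⟨L, h_av, h_lt, h_small, h_large, h_len⟩ :=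
    exists_selfAvoiding_join (N := N) (T := T) (w := w) (by omega)
      (fun d => g.map fun a => (a + d) % N)
      (fun d a ha => by
        obtain ⟨b, _, rfl⟩ := List.mem_map.1 ha
        exact Nat.mod_lt _ (by omega))
      (fun d => hg_av.map fun a ha b hb hab => by
        have : a ≡ b [MOD N] := Nat.ModEq.add_right_cancel' d hab
        exact Nat.ModEq.eq_of_lt_of_lt this (hg_lt a ha) (hg_lt b hb))
  refine HasBalancedWord.of_length_le (hM.trans ?_) h_av h_lt fun a => ?_
  · simpa [hg_len] using h_len
  · rcases lt_or_ge a N with ha | ha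
    · rw [h_small a ha]
      refine le_trans (le_of_eq ?_) hKk
      rw [← hg_len]
      exact sum_count_rotations hg_lt ha
    · exact (h_large a ha).trans (by omega)

lemma count_drop_take (L : List ℕ) (i a b : ℕ) (hab : a ≤ b) (hb : b ≤ L.length) :
    ((L.take b).drop a).count i = ((Finset.Ico a b).filter fun r => L[r]? = some i).card := by
  induction b, hab using Nat.le_induction with
  | base => simp
  | succ b hab ih =>
    have hb' : b < L.length := hb
    rw [List.take_add_one, List.drop_append_of_le_length (by simp; omega), List.count_append,
      ih hb'.le, ← Finset.insert_Ico_right_eq_Ico_add_one hab, Finset.filter_insert,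
      List.getElem?_eq_getElem hb']
    by_cases h : L[b] = i
    · simp [h]
    · simp [h]

/-- The defining property of self-avoiding words in terms of positions. -/
lemma SelfAvoiding.exists_odd_card {L : List ℕ} (h : SelfAvoiding L) {M : ℕ} (hM : L.length = M)
    {I : Finset (Fin M)} (hI : I.Nonempty) (hc : (I : Set (Fin M)).OrdConnected) :
    ∃ i, Odd (I.filter fun r : Fin M => L[(r : ℕ)]? = some i).card := by
  set a := I.min' hI
  set b := I.max' hI
  have hab : a ≤ b := I.min'_le_max' hI
  have hIcc : I = Finset.Icc a b := by
    ext r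
    rw [Finset.mem_Icc]
    exact ⟨fun hr => ⟨I.min'_le r hr, I.le_max' r hr⟩,
      fun hr => hc.out (I.min'_mem hI) (I.max'_mem hI) hr⟩
  have hlen : ((L.take (b + 1)).drop a).length = b + 1 - a := by
    simp only [List.length_drop, List.length_take]
    have := b.2
    omega
  have hab' : (a : ℕ) ≤ b := hab
  obtain ⟨i, hi⟩ := h ((L.take (b + 1)).drop a)
    ((List.drop_suffix _ _).isInfix.trans (List.take_prefix _ _).isInfix)
    (List.ne_nil_of_length_pos (by omega))
  refine ⟨i, ?_⟩
  rw [count_drop_take L i a (b + 1) (by omega) (by have := b.2; omega)] at hi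
  rw [hIcc, ← Finset.card_map Fin.valEmbedding]
  convert hi using 2
  ext r
  simp only [Finset.mem_map, Finset.mem_filter, Finset.mem_Icc, Fin.valEmbedding_apply,
    Finset.mem_Ico]
  constructor
  · rintro ⟨r, ⟨⟨h1, h2⟩, h3⟩, rfl⟩
    exact ⟨⟨h1, Nat.lt_succ_of_le h2⟩, h3⟩
  · rintro ⟨⟨h1, h2⟩, h3⟩
    exact ⟨⟨r, by have := b.2; omega⟩, ⟨⟨h1, Nat.le_of_lt_succ h2⟩, h3⟩, rfl⟩

/-! ### Polygons and their edges -/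

lemma eventually_apply_lt {f : Plane →ₗ[ℝ] ℝ} {c : ℝ} {x : Plane} (h : f x < c) (v : Plane) :
    ∀ᶠ t : ℝ in 𝓝 0, f (x + t • v) < c := by
  have hc : Continuous fun t : ℝ => f (x + t • v) := by
    simp only [map_add, map_smul]
    fun_prop
  exact hc.continuousAt.eventually_lt_const (by simpa using h)

lemma exists_apply_ne_zero {f : Plane →ₗ[ℝ] ℝ} (hf : f ≠ 0) : ∃ v, f v ≠ 0 := by
  by_contra! h
  exact hf (LinearMap.ext h)

lemma finrank_ker_eq_one {f : Plane →ₗ[ℝ] ℝ} (hf : f ≠ 0) :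
    Module.finrank ℝ (LinearMap.ker f) = 1 := by
  have h := f.finrank_range_add_finrank_ker
  rw [LinearMap.range_eq_top.2 (LinearMap.surjective hf), finrank_top, Module.finrank_self,
    Module.finrank_fin_fun] at h
  omega

/-- In the plane, two linear functionals that vanish on a common non-zero vector are
proportional. -/
lemma exists_eq_smul_of_apply_eq_zero {f g : Plane →ₗ[ℝ] ℝ} {d : Plane} (hf : f ≠ 0) (hd : d ≠ 0)
    (hfd : f d = 0) (hgd : g d = 0) : ∃ r : ℝ, g = r • f := by
  obtain ⟨v, hv⟩ := exists_apply_ne_zero hf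
  refine ⟨g v / f v, LinearMap.ext fun x => ?_⟩
  have hker : x - (f x / f v) • v ∈ LinearMap.ker f := by
    simp [LinearMap.mem_ker, hv]
  obtain ⟨t, ht⟩ := (finrank_eq_one_iff_of_nonzero' (⟨d, hfd⟩ : LinearMap.ker f)
    (by simpa [Subtype.ext_iff] using hd)).1 (finrank_ker_eq_one hf) ⟨_, hker⟩
  have ht' : t • d = x - (f x / f v) • v := congrArg Subtype.val ht
  have h0 : g (x - (f x / f v) • v) = 0 := by rw [← ht', map_smul, hgd, smul_zero]
  rw [map_sub, map_smul, sub_eq_zero, smul_eq_mul] at h0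
  rw [h0, LinearMap.smul_apply, smul_eq_mul]
  ring

/-- The half-planes `f j x ≤ c j` form an irredundant description of the set `P` with non-empty
interior: for every `j` some point violates no constraint and is tight for the `j`-th one only. -/
structure IsFacetSystem (P : Set Plane) {ι : Type*} (f : ι → Plane →ₗ[ℝ] ℝ) (c : ι → ℝ) :
    Prop where
  eq : P = {x | ∀ j, f j x ≤ c j}
  inner : ∃ o, ∀ j, f j o < c j
  facet : ∀ j, ∃ y, f j y = c j ∧ ∀ i, i ≠ j → f i y < c i

namespace IsFacetSystem

variable {P : Set Plane} {ι : Type*} {f : ι → Plane →ₗ[ℝ] ℝ} {c : ι → ℝ}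

lemma mem_iff (h : IsFacetSystem P f c) {x : Plane} : x ∈ P ↔ ∀ j, f j x ≤ c j := by
  rw [h.eq, Set.mem_ofPred_eq]

lemma exists_facet_mem (h : IsFacetSystem P f c) (j : ι) :
    ∃ y ∈ P, f j y = c j ∧ ∀ i, i ≠ j → f i y < c i := by
  obtain ⟨y, hy, hlt⟩ := h.facet j
  refine ⟨y, h.mem_iff.2 fun i => ?_, hy, hlt⟩
  by_cases hi : i = j
  · rw [hi, hy]
  · exact (hlt i hi).le

lemma ne_zero (h : IsFacetSystem P f c) (j : ι) : f j ≠ 0 := by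
  intro h0
  obtain ⟨o, ho⟩ := h.inner
  obtain ⟨y, hy, -⟩ := h.facet j
  have := ho j
  simp only [h0, LinearMap.zero_apply] at this hy
  linarith

lemma interior_eq [Finite ι] (h : IsFacetSystem P f c) : interior P = {x | ∀ j, f j x < c j} := by
  apply Set.Subset.antisymm
  · intro x hx j
    obtain ⟨v, hv⟩ := exists_apply_ne_zero (h.ne_zero j)
    have hc : Continuous fun t : ℝ => x + (t * f j v) • v := by fun_prop
    have hev : ∀ᶠ t : ℝ in 𝓝 0, x + (t * f j v) • v ∈ interior P :=
      hc.continuousAt.eventually_mem (by simpa using isOpen_interior.mem_nhds hx)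
    obtain ⟨t, ht, ht0⟩ := ((hev.filter_mono nhdsWithin_le_nhds).and
      (self_mem_nhdsWithin (s := Set.Ioi (0 : ℝ)))).exists
    have h1 := h.mem_iff.1 (interior_subset ht) j
    rw [map_add, map_smul, smul_eq_mul] at h1
    have : 0 < t * f j v * f j v := by
      rw [mul_assoc]
      exact mul_pos ht0 (mul_self_pos.2 hv)
    linarith
  · refine interior_maximal (fun x hx => h.mem_iff.2 fun j => (hx j).le) ?_
    rw [Set.ofPred_forall]
    exact isOpen_iInter_of_finite fun j =>
      isOpen_lt (LinearMap.continuous_of_finiteDimensional (f j)) continuous_const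

lemma convex (h : IsFacetSystem P f c) : Convex ℝ P := by
  have : P = ⋂ j, {x | f j x ≤ c j} := by rw [h.eq, Set.ofPred_forall]
  rw [this]
  exact convex_iInter fun j => convex_halfSpace_le (f j).isLinear (c j)

lemma interior_nonempty [Finite ι] (h : IsFacetSystem P f c) : (interior P).Nonempty := by
  rw [h.interior_eq]
  exact h.inner

lemma isPolygon [Finite ι] (h : IsFacetSystem P f c) : IsPolygon P := by
  refine ⟨⟨Set.range fun j => {x | f j x ≤ c j}, Set.finite_range _, ?_, ?_⟩,
    h.interior_nonempty⟩
  · rintro _ ⟨j, rfl⟩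
    exact ⟨f j, c j, h.ne_zero j, rfl⟩
  · rw [Set.sInter_range, h.eq, Set.ofPred_forall]

lemma finrank_vectorSpan_ne_one [Finite ι] (h : IsFacetSystem P f c) :
    Module.finrank ℝ (vectorSpan ℝ P) ≠ 1 := by
  have := h.convex.interior_nonempty_iff_affineSpan_eq_top.1 h.interior_nonempty
  rw [← direction_affineSpan, this, AffineSubspace.direction_top, finrank_top,
    Module.finrank_fin_fun]
  norm_num

/-- Each boundary line meets `P` in at least two points, `y` and `y + d`. -/
lemma exists_ne_mem_line [Finite ι] (h : IsFacetSystem P f c) (j : ι) :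
    ∃ y d, d ≠ 0 ∧ f j d = 0 ∧ f j y = c j ∧ y ∈ P ∧ y + d ∈ P := by
  obtain ⟨y, hyP, hy, hlt⟩ := h.exists_facet_mem j
  obtain ⟨v, hv0, hv⟩ : ∃ v : Plane, v ≠ 0 ∧ f j v = 0 := by
    obtain ⟨v, hv⟩ := (Module.finrank_pos_iff_exists_ne_zero (R := ℝ)
      (M := LinearMap.ker (f j))).1 (by rw [finrank_ker_eq_one (h.ne_zero j)]; norm_num)
    exact ⟨v, by simpa using hv, v.2⟩
  have hev : ∀ᶠ t : ℝ in 𝓝 0, ∀ i, i ≠ j → f i (y + t • v) < c i := by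
    rw [eventually_all]
    intro i
    by_cases hi : i = j
    · simp [hi]
    · filter_upwards [eventually_apply_lt (hlt i hi) v] with t ht _ using ht
  obtain ⟨t, ht, ht0⟩ := ((hev.filter_mono nhdsWithin_le_nhds).and
    (self_mem_nhdsWithin (s := {(0 : ℝ)}ᶜ))).exists
  refine ⟨y, t • v, smul_ne_zero ht0 hv0, by simp [hv], hy, hyP, h.mem_iff.2 fun i => ?_⟩
  by_cases hi : i = j
  · subst hi
    simp [hv, hy]
  · exact (ht i hi).le

lemma isEdge [Finite ι] (h : IsFacetSystem P f c) (j : ι) : IsEdge P {x ∈ P | f j x = c j} := by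
  obtain ⟨y, d, hd0, hd, hy, hyP, hyd⟩ := h.exists_ne_mem_line j
  refine ⟨fun _ => ⟨LinearMap.toContinuousLinearMap (f j), ?_⟩, ?_⟩
  · ext x
    simp only [Set.mem_ofPred_eq, LinearMap.coe_toContinuousLinearMap']
    refine and_congr_right fun hx => ⟨fun hxc z hz => hxc ▸ h.mem_iff.1 hz j, fun hmax => ?_⟩
    exact le_antisymm (h.mem_iff.1 hx j) (hy ▸ hmax y hyP)
  · apply le_antisymm
    · rw [← finrank_ker_eq_one (h.ne_zero j)]
      apply Submodule.finrank_mono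
      rw [vectorSpan_def, Submodule.span_le]
      rintro _ ⟨a, ha, b, hb, rfl⟩
      simp [LinearMap.mem_ker, ha.2, hb.2]
    · rw [Submodule.one_le_finrank_iff, Submodule.ne_bot_iff]
      refine ⟨d, ?_, hd0⟩
      have := vsub_mem_vectorSpan ℝ (s := {x ∈ P | f j x = c j}) (p₁ := y + d) (p₂ := y)
        ⟨hyd, by simp [hd, hy]⟩ ⟨hyP, hy⟩
      simpa using this

lemma exists_eq_of_isEdge [Finite ι] (h : IsFacetSystem P f c) {I : Set Plane} (hI : IsEdge P I) :
    ∃ j, I = {x ∈ P | f j x = c j} := by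
  obtain ⟨hexp, hrank⟩ := hI
  have hnt : I.Nontrivial := by
    by_contra hs
    rw [Set.not_nontrivial_iff] at hs
    rw [vectorSpan_of_subsingleton ℝ hs, finrank_bot] at hrank
    exact zero_ne_one hrank
  obtain ⟨p, hp, q, hq, hpq⟩ := hnt
  obtain ⟨l, hl⟩ := hexp ⟨p, hp⟩
  have hl0 : l.toLinearMap ≠ 0 := by
    intro h0
    have h0' : ∀ x, l x = 0 := fun x => DFunLike.congr_fun h0 x
    have hIP : I = P := by
      rw [hl]
      simp [h0']
    exact h.finrank_vectorSpan_ne_one (hIP ▸ hrank)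
  have hpP : p ∈ P := by rw [hl] at hp; exact hp.1
  have hqP : q ∈ P := by rw [hl] at hq; exact hq.1
  have hlpq : l p = l q := by
    rw [hl] at hp hq
    exact le_antisymm (hq.2 p hpP) (hp.2 q hqP)
  have hmax : ∀ x ∈ P, l x ≤ l p := by rw [hl] at hp; exact hp.2
  have hIeq : I = {x ∈ P | l x = l p} := by
    rw [hl]
    ext x
    exact and_congr_right fun hx => ⟨fun hm => le_antisymm (hmax x hx) (hm p hpP),
      fun hm y hy => hm ▸ hmax y hy⟩
  -- The midpoint of `p` and `q` is a maximum of `l`, so it cannot be an interior point.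
  obtain ⟨j, hj⟩ : ∃ j, c j ≤ f j (midpoint ℝ p q) := by
    by_contra! hlt
    obtain ⟨v, hv⟩ := exists_apply_ne_zero hl0
    have hev : ∀ᶠ t : ℝ in 𝓝 0, ∀ j, f j (midpoint ℝ p q + t • (l v • v)) < c j :=
      eventually_all.2 fun j => eventually_apply_lt (hlt j) _
    obtain ⟨t, ht, ht0⟩ := ((hev.filter_mono nhdsWithin_le_nhds).and
      (self_mem_nhdsWithin (s := Set.Ioi (0 : ℝ)))).exists
    have h1 := hmax _ (h.mem_iff.2 fun j => (ht j).le)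
    have h2 : l (midpoint ℝ p q) = l p := by
      rw [midpoint_eq_smul_add, map_smul, map_add, ← hlpq, smul_eq_mul, invOf_eq_inv]
      ring
    rw [map_add, h2, map_smul, map_smul, smul_eq_mul, smul_eq_mul] at h1
    have : 0 < t * (l v * l v) := mul_pos ht0 (mul_self_pos.2 hv)
    linarith
  rw [midpoint_eq_smul_add, map_smul, map_add, smul_eq_mul, invOf_eq_inv] at hj
  have hpj := h.mem_iff.1 hpP j
  have hqj := h.mem_iff.1 hqP j
  have hfp : f j p = c j := by linarith
  have hfq : f j q = c j := by linarith
  obtain ⟨r, hr⟩ := exists_eq_smul_of_apply_eq_zero (g := l.toLinearMap) (h.ne_zero j)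
    (sub_ne_zero.2 hpq) (by simp [hfp, hfq]) (by simp [hlpq])
  have hr' : ∀ x, l x = r * f j x := fun x => DFunLike.congr_fun hr x
  have hr0 : r ≠ 0 := by
    rintro rfl
    exact hl0 (by rw [hr, zero_smul])
  refine ⟨j, ?_⟩
  rw [hIeq]
  ext x
  simp only [Set.mem_ofPred_eq, hr', hfp, mul_right_inj' hr0]

lemma encard_edges [Finite ι] (h : IsFacetSystem P f c) :
    {I : Set Plane | IsEdge P I}.encard = Nat.card ι := by
  have hrange : {I : Set Plane | IsEdge P I} = Set.range fun j => {x ∈ P | f j x = c j} := by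
    ext I
    constructor
    · intro hI
      obtain ⟨j, rfl⟩ := h.exists_eq_of_isEdge hI
      exact ⟨j, rfl⟩
    · rintro ⟨j, rfl⟩
      exact h.isEdge j
  have hinj : Function.Injective fun j => {x ∈ P | f j x = c j} := by
    intro i j hij
    by_contra hne
    obtain ⟨y, hyP, hy, hlt⟩ := h.exists_facet_mem i
    have hmem : y ∈ {x ∈ P | f i x = c i} := ⟨hyP, hy⟩
    rw [show {x ∈ P | f i x = c i} = {x ∈ P | f j x = c j} from hij] at hmem
    exact (hlt j (Ne.symm hne)).ne hmem.2
  rw [hrange, ← Set.image_univ, hinj.encard_image, Set.encard_univ, ENat.card_eq_coe_natCard]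

end IsFacetSystem

/-- A linear functional bounded on a set is strictly below its bound at interior points. -/
lemma apply_lt_of_mem_interior {P : Set Plane} {f : Plane →ₗ[ℝ] ℝ} {c : ℝ} (hf : f ≠ 0)
    (hP : ∀ x ∈ P, f x ≤ c) {x : Plane} (hx : x ∈ interior P) : f x < c := by
  have h : IsFacetSystem {x | f x ≤ c} (fun _ : Unit => f) fun _ => c := by
    obtain ⟨v, hv⟩ := exists_apply_ne_zero hf
    refine ⟨by simp, ⟨((c - 1) / f v) • v, fun _ => ?_⟩, fun _ => ⟨(c / f v) • v, ?_, by simp⟩⟩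
    · rw [map_smul, smul_eq_mul, div_mul_cancel₀ _ hv]
      linarith
    · rw [map_smul, smul_eq_mul, div_mul_cancel₀ _ hv]
  have := interior_mono (show P ⊆ {x | f x ≤ c} from hP) hx
  rw [h.interior_eq] at this
  exact this ()

/-- Discarding half-planes as long as possible leaves a facet system. -/
lemma IsPolygon.exists_isFacetSystem {P : Set Plane} (hP : IsPolygon P) :
    ∃ (m : ℕ) (f : Fin m → Plane →ₗ[ℝ] ℝ) (c : Fin m → ℝ), IsFacetSystem P f c := by
  obtain ⟨⟨H, hfin, hH, hPH⟩, o, ho⟩ := hP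
  have hfinS : {S : Set (Set Plane) | S ⊆ H ∧ P = ⋂₀ S}.Finite :=
    hfin.finite_subsets.subset fun S hS => hS.1
  obtain ⟨S, hS⟩ := hfinS.exists_minimal ⟨H, subset_rfl, hPH⟩
  have hSH := hS.prop.1
  have hPS := hS.prop.2
  choose! F C hF0 hFC using hH
  have e : Fin (Nat.card S) ≃ S := by
    have := (hfin.subset hSH).to_subtype
    exact (Finite.equivFin S).symm
  have hmem : ∀ A ∈ S, ∀ x, x ∈ A ↔ F A x ≤ C A := by
    intro A hA x
    conv_lhs => rw [hFC A (hSH hA)]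
    rfl
  have hPS' : ∀ x, x ∈ P ↔ ∀ A ∈ S, F A x ≤ C A := by
    intro x
    rw [hPS, Set.mem_sInter]
    exact forall₂_congr fun A hA => hmem A hA x
  have hoA : ∀ A ∈ S, F A o < C A := fun A hA =>
    apply_lt_of_mem_interior (hF0 A (hSH hA)) (fun x hx => (hPS' x).1 hx A hA) ho
  refine ⟨Nat.card S, fun j => F (e j), fun j => C (e j), ?_, ⟨o, fun j => hoA _ (e j).2⟩, ?_⟩
  · ext x
    rw [hPS', Set.mem_ofPred_eq]
    exact ⟨fun hx j => hx _ (e j).2, fun hx A hA => by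
      have := hx (e.symm ⟨A, hA⟩)
      rwa [e.apply_symm_apply] at this⟩
  · intro j
    obtain ⟨z, hzS, hzP⟩ : ∃ z, (∀ A ∈ S, A ≠ e j → F A z ≤ C A) ∧ z ∉ P := by
      by_contra! hcon
      have hsub : S \ {(e j : Set Plane)} ∈ {S : Set (Set Plane) | S ⊆ H ∧ P = ⋂₀ S} := by
        refine ⟨Set.sdiff_subset.trans hSH, Set.Subset.antisymm ?_ fun z hz => ?_⟩
        · rw [hPS]
          exact Set.sInter_subset_sInter Set.sdiff_subset
        · exact hcon z fun A hA hne => (hmem A hA z).1 (hz A ⟨hA, hne⟩)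
      exact (hS.le_of_le hsub Set.sdiff_subset (e j).2).2 rfl
    have hzj : C (e j) < F (e j) z := by
      by_contra! hle
      refine hzP ((hPS' z).2 fun A hA => ?_)
      by_cases hA' : A = e j
      · rw [hA']
        exact hle
      · exact hzS A hA hA'
    -- The segment from `o` to `z` crosses the line in a point where all other constraints are strict.
    have hoj := hoA _ (e j).2
    set t : ℝ := (C (e j) - F (e j) o) / (F (e j) z - F (e j) o) with ht
    have hden : 0 < F (e j) z - F (e j) o := by linarith
    have ht0 : 0 < t := div_pos (by linarith) hden
    have ht1 : t < 1 := (div_lt_one hden).2 (by linarith)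
    have htm : t * (F (e j) z - F (e j) o) = C (e j) - F (e j) o := div_mul_cancel₀ _ hden.ne'
    refine ⟨o + t • (z - o), ?_, fun i hi => ?_⟩
    · rw [map_add, map_smul, map_sub, smul_eq_mul, htm]
      ring
    · have h1 := hoA _ (e i).2
      have h2 := hzS _ (e i).2 (fun h => hi (e.injective (Subtype.ext h)))
      rw [map_add, map_smul, map_sub, smul_eq_mul]
      nlinarith

lemma IsPolygonWithEdges.exists_isFacetSystem {m : ℕ} {P : Set Plane}
    (hP : IsPolygonWithEdges m P) :
    ∃ (f : Fin m → Plane →ₗ[ℝ] ℝ) (c : Fin m → ℝ), IsFacetSystem P f c := by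
  obtain ⟨m', f, c, h⟩ := hP.1.exists_isFacetSystem
  have hm := h.encard_edges
  rw [hP.2, Nat.card_fin] at hm
  obtain rfl : m = m' := by exact_mod_cast hm
  exact ⟨f, c, h⟩

/-! ### Affine polynomials -/

/-- The polynomial of the affine function `x ↦ c - f x`. -/
noncomputable def slack (f : Plane →ₗ[ℝ] ℝ) (c : ℝ) : MvPolynomial (Fin 2) ℝ :=
  MvPolynomial.C c - (MvPolynomial.C (f (Pi.single 0 1)) * MvPolynomial.X 0
    + MvPolynomial.C (f (Pi.single 1 1)) * MvPolynomial.X 1)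

lemma apply_eq (f : Plane →ₗ[ℝ] ℝ) (x : Plane) :
    f x = f (Pi.single 0 1) * x 0 + f (Pi.single 1 1) * x 1 := by
  have hx : x = x 0 • Pi.single 0 1 + x 1 • Pi.single 1 1 := by
    ext i
    fin_cases i <;> simp
  conv_lhs => rw [hx]
  rw [map_add, map_smul, map_smul, smul_eq_mul, smul_eq_mul]
  ring

@[simp] lemma eval_slack (f : Plane →ₗ[ℝ] ℝ) (c : ℝ) (x : Plane) :
    MvPolynomial.eval x (slack f c) = c - f x := by
  rw [apply_eq f x]
  simp [slack]

lemma totalDegree_slack_le (f : Plane →ₗ[ℝ] ℝ) (c : ℝ) : (slack f c).totalDegree ≤ 1 := by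
  have h : ∀ (a : ℝ) (i : Fin 2),
      (MvPolynomial.C a * MvPolynomial.X i : MvPolynomial (Fin 2) ℝ).totalDegree ≤ 1 := fun a i =>
    (MvPolynomial.totalDegree_mul _ _).trans
      (by rw [MvPolynomial.totalDegree_C, MvPolynomial.totalDegree_X])
  refine (MvPolynomial.totalDegree_sub _ _).trans (max_le (by simp) ?_)
  exact (MvPolynomial.totalDegree_add _ _).trans (max_le (h _ _) (h _ _))

lemma exists_eval_eq_of_totalDegree_le_one {a : MvPolynomial (Fin 2) ℝ} (ha : a.totalDegree ≤ 1) :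
    ∃ (g : Plane →ₗ[ℝ] ℝ) (r : ℝ), ∀ x, MvPolynomial.eval x a = r + g x := by
  rw [a.as_sum]
  refine Finset.sum_induction _ (fun q : MvPolynomial (Fin 2) ℝ =>
    ∃ (g : Plane →ₗ[ℝ] ℝ) (r : ℝ), ∀ x, MvPolynomial.eval x q = r + g x) ?_
    ⟨0, 0, by simp⟩ ?_
  · rintro p q ⟨g, r, hp⟩ ⟨g', r', hq⟩
    refine ⟨g + g', r + r', fun x => ?_⟩
    rw [map_add, hp, hq, LinearMap.add_apply]
    ring
  · intro d hd
    have hdeg := (MvPolynomial.le_totalDegree hd).trans ha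
    have hd2 : d 0 + d 1 ≤ 1 := by
      rwa [Finsupp.sum_fintype _ _ (fun _ => rfl), Fin.sum_univ_two] at hdeg
    have heval : ∀ x : Plane, MvPolynomial.eval x (MvPolynomial.monomial d (a.coeff d))
        = a.coeff d * (x 0 ^ d 0 * x 1 ^ d 1) := by
      intro x
      rw [MvPolynomial.eval_monomial, Finsupp.prod_fintype _ _ (fun _ => pow_zero _),
        Fin.prod_univ_two]
    rcases (by omega : d 0 = 0 ∧ d 1 = 0 ∨ d 0 = 1 ∧ d 1 = 0 ∨ d 0 = 0 ∧ d 1 = 1) with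
      ⟨h0, h1⟩ | ⟨h0, h1⟩ | ⟨h0, h1⟩
    · exact ⟨0, a.coeff d, fun x => by rw [heval, h0, h1]; simp⟩
    · exact ⟨a.coeff d • LinearMap.proj 0, 0, fun x => by rw [heval, h0, h1]; simp⟩
    · exact ⟨a.coeff d • LinearMap.proj 1, 0, fun x => by rw [heval, h0, h1]; simp⟩

lemma IsFacetSystem.slack_factor {P : Set Plane} {ι : Type*} [Finite ι] {f : ι → Plane →ₗ[ℝ] ℝ}
    {c : ι → ℝ} (h : IsFacetSystem P f c) (j : ι) :
    (slack (f j) (c j)).totalDegree ≤ 1 ∧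
      (∀ x ∈ P, 0 ≤ MvPolynomial.eval x (slack (f j) (c j))) ∧
      ∃ I, IsEdge P I ∧ ∀ x ∈ I, MvPolynomial.eval x (slack (f j) (c j)) = 0 := by
  refine ⟨totalDegree_slack_le _ _, fun x hx => ?_, _, h.isEdge j, fun x hx => ?_⟩
  · rw [eval_slack]
    exact sub_nonneg.2 (h.mem_iff.1 hx j)
  · rw [eval_slack, hx.2, sub_self]

/-- Up to a scalar, the only affine function that vanishes on an edge is the slack of the
corresponding constraint. -/
lemma IsFacetSystem.exists_eval_eq_mul {P : Set Plane} {ι : Type*} [Finite ι]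
    {f : ι → Plane →ₗ[ℝ] ℝ} {c : ι → ℝ} (h : IsFacetSystem P f c) {a : MvPolynomial (Fin 2) ℝ}
    (ha : a.totalDegree ≤ 1) {I : Set Plane} (hI : IsEdge P I)
    (ha0 : ∀ x ∈ I, MvPolynomial.eval x a = 0) :
    ∃ j, ∃ r : ℝ, ∀ x, MvPolynomial.eval x a = r * (c j - f j x) := by
  obtain ⟨j, rfl⟩ := h.exists_eq_of_isEdge hI
  obtain ⟨g, s, hg⟩ := exists_eval_eq_of_totalDegree_le_one ha
  obtain ⟨y, d, hd0, hd, hy, hyP, hyd⟩ := h.exists_ne_mem_line j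
  have h1 := ha0 y ⟨hyP, hy⟩
  have h2 := ha0 (y + d) ⟨hyd, by simp [hd, hy]⟩
  rw [hg] at h1 h2
  rw [map_add] at h2
  obtain ⟨r, rfl⟩ := exists_eq_smul_of_apply_eq_zero (g := g) (h.ne_zero j) hd0 hd (by linarith)
  refine ⟨j, -r, fun x => ?_⟩
  simp only [LinearMap.smul_apply, smul_eq_mul, hy] at h1 hg
  rw [hg]
  linear_combination h1

/-! ### The angular order of the edges -/

/-- The bilinear pairing of two vectors of the plane `ℂ = ℝ²`. -/
def dot (z x : ℂ) : ℝ := z.re * x.re + z.im * x.im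

/-- The determinant of two vectors of the plane `ℂ = ℝ²`. -/
def cross (z w : ℂ) : ℝ := z.re * w.im - z.im * w.re

lemma cross_eq_sin (z w : ℂ) : cross z w = ‖z‖ * ‖w‖ * Real.sin (w.arg - z.arg) := by
  rw [cross, ← Complex.norm_mul_cos_arg z, ← Complex.norm_mul_sin_arg z,
    ← Complex.norm_mul_cos_arg w, ← Complex.norm_mul_sin_arg w, Real.sin_sub]
  ring

lemma dot_eq_cos (z w : ℂ) : dot z w = ‖z‖ * ‖w‖ * Real.cos (w.arg - z.arg) := by
  rw [dot, ← Complex.norm_mul_cos_arg z, ← Complex.norm_mul_sin_arg z,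
    ← Complex.norm_mul_cos_arg w, ← Complex.norm_mul_sin_arg w, Real.cos_sub]
  ring

/-- If `b` lies in the interior of the convex cone spanned by `a` and `c`, and the constraint
`dot b · ≤ 1` is not implied by those of `a` and `c`, then it is violated wherever neither of the
other two is strictly satisfied: `b = α a + β c` with `α + β > 1`. -/
lemma one_lt_dot_of_cross_pos {a b c x y : ℂ} (hab : 0 < cross a b) (hbc : 0 < cross b c)
    (hac : 0 < cross a c) (hya : dot a y < 1) (hyb : dot b y = 1) (hyc : dot c y < 1)
    (hxa : 1 ≤ dot a x) (hxc : 1 ≤ dot c x) : 1 < dot b x := by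
  have key : ∀ z, cross a c * dot b z = cross b c * dot a z + cross a b * dot c z := by
    intro z
    simp only [cross, dot]
    ring
  have h1 : cross a c < cross b c + cross a b := by
    have := key y
    rw [hyb] at this
    nlinarith
  have h2 := key x
  have h3 : cross a c * 1 < cross a c * dot b x := by nlinarith
  exact lt_of_mul_lt_mul_left h3 hac.le

/-- Constraints `dot (w j) · ≤ 1`, each tight at a point where the others are strict, can be sorted
by angle, starting from the last one, in such a way that the violated ones are consecutive as long
as the last one is satisfied. -/
lemma exists_angular_order {M : ℕ} {w y : Fin (M + 1) → ℂ} (hy : ∀ j, dot (w j) (y j) = 1)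
    (hlt : ∀ i j, i ≠ j → dot (w i) (y j) < 1) :
    ∃ σ : Equiv.Perm (Fin M), ∀ x, dot (w (Fin.last M)) x ≤ 1 → ∀ r s t, r < s → s < t →
      1 ≤ dot (w (σ r).castSucc) x → 1 ≤ dot (w (σ t).castSucc) x →
        1 < dot (w (σ s).castSucc) x := by
  set l := w (Fin.last M) with hl
  have hw0 : ∀ j, w j ≠ 0 := by
    intro j h0
    have := hy j
    simp [h0, dot] at this
  -- Rotate the plane so that the last vector points in the direction of the negative real axis.
  set z : Fin (M + 1) → ℂ := fun j => -(w j * (starRingEnd ℂ) l) with hz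
  have hz0 : ∀ j, z j ≠ 0 := fun j =>
    neg_ne_zero.2 (mul_ne_zero (hw0 j) ((map_ne_zero _).2 (hw0 _)))
  set θ : Fin (M + 1) → ℝ := fun j => (z j).arg with hθ
  have hl2 : 0 < l.re * l.re + l.im * l.im := by
    have := Complex.normSq_pos.2 (hw0 (Fin.last M))
    rwa [Complex.normSq_apply] at this
  have hcross_z : ∀ i j,
      cross (z i) (z j) = cross (w i) (w j) * (l.re * l.re + l.im * l.im) := by
    intro i j
    simp [hz, cross]
    ring
  have hdot_z : ∀ i j, dot (z i) (z j) = dot (w i) (w j) * (l.re * l.re + l.im * l.im) := by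
    intro i j
    simp [hz, dot]
    ring
  have hcross : ∀ i j, 0 < Real.sin (θ j - θ i) → 0 < cross (w i) (w j) := by
    intro i j hs
    have h1 : 0 < cross (z i) (z j) := by
      rw [cross_eq_sin]
      exact mul_pos (mul_pos (norm_pos_iff.2 (hz0 i)) (norm_pos_iff.2 (hz0 j))) hs
    rw [hcross_z] at h1
    exact pos_of_mul_pos_left h1 hl2.le
  have hθinj : Function.Injective θ := by
    intro i j hij
    by_contra hne
    have h1 := (Complex.arg_eq_arg_iff (hz0 i) (hz0 j)).1 hij
    set q : ℝ := ‖z j‖ / ‖z i‖ with hq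
    have hq0 : 0 < q := div_pos (norm_pos_iff.2 (hz0 j)) (norm_pos_iff.2 (hz0 i))
    have h2 : w j = q * w i := by
      apply mul_right_cancel₀ ((map_ne_zero (starRingEnd ℂ)).2 (hw0 (Fin.last M)))
      have h3 : (q : ℂ) * z i = z j := by
        rw [← h1, hq]
        push_cast
        rfl
      simp only [hz] at h3
      linear_combination h3
    have h4 : ∀ x, dot (w j) x = q * dot (w i) x := by
      intro x
      simp [h2, dot]
      ring
    have h5 := hlt j i (Ne.symm hne)
    have h6 := hlt i j hne
    have h7 := hy j
    rw [h4, hy i] at h5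
    rw [h4] at h7
    nlinarith
  have hθl : θ (Fin.last M) = Real.pi := by
    have : z (Fin.last M) = ((-(l.re * l.re + l.im * l.im) : ℝ) : ℂ) := by
      apply Complex.ext <;> simp [hz, ← hl]
      ring
    simp only [hθ, this]
    exact Complex.arg_ofReal_of_neg (by linarith)
  have hθlt : ∀ j : Fin M, θ j.castSucc < Real.pi := fun j =>
    lt_of_le_of_ne (Complex.arg_le_pi _)
      fun h => (Fin.castSucc_lt_last j).ne (hθinj (h.trans hθl.symm))
  set σ := Tuple.sort fun j : Fin M => θ j.castSucc
  have hmono : StrictMono fun j : Fin M => θ (σ j).castSucc :=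
    (Tuple.monotone_sort fun j : Fin M => θ j.castSucc).strictMono_of_injective
      fun i j hij => σ.injective (Fin.castSucc_injective M (hθinj hij))
  refine ⟨σ, fun x hxl r s t hrs hst hr ht => ?_⟩
  have hne : ∀ {i j : Fin M}, i ≠ j → (σ i).castSucc ≠ (σ j).castSucc := fun h e =>
    h (σ.injective (Fin.castSucc_injective M e))
  have hab := hmono hrs
  have hbc := hmono hst
  have hca := hθlt (σ t)
  have hpa : -Real.pi < θ (σ r).castSucc := Complex.neg_pi_lt_arg _
  have hab' := hne hrs.ne
  have hcb' := hne hst.ne'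
  have hal := (Fin.castSucc_lt_last (σ r)).ne
  have hcl := (Fin.castSucc_lt_last (σ t)).ne
  simp only at hab hbc
  generalize (σ r).castSucc = a at *
  generalize (σ s).castSucc = b at *
  generalize (σ t).castSucc = c at *
  rcases lt_trichotomy (θ c - θ a) Real.pi with h | h | h
  · exact one_lt_dot_of_cross_pos (hcross _ _ (Real.sin_pos_of_pos_of_lt_pi (by linarith)
      (by linarith))) (hcross _ _ (Real.sin_pos_of_pos_of_lt_pi (by linarith) (by linarith)))
      (hcross _ _ (Real.sin_pos_of_pos_of_lt_pi (by linarith) h)) (hlt a b hab') (hy b)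
      (hlt c b hcb') hr ht
  · -- Opposite vectors cannot both have positive pairing with `x`.
    exfalso
    have hsin : cross (z a) (z c) = 0 := by
      rw [cross_eq_sin, show (z c).arg - (z a).arg = Real.pi from h, Real.sin_pi, mul_zero]
    have hcos : dot (z a) (z c) < 0 := by
      rw [dot_eq_cos, show (z c).arg - (z a).arg = Real.pi from h, Real.cos_pi]
      have := mul_pos (norm_pos_iff.2 (hz0 a)) (norm_pos_iff.2 (hz0 c))
      linarith
    rw [hcross_z] at hsin
    rw [hdot_z] at hcos
    have h0 := (mul_eq_zero.1 hsin).resolve_right hl2.ne'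
    have hneg : dot (w a) (w c) < 0 := neg_of_mul_neg_left hcos hl2.le
    have hid : dot (w a) (w a) * dot (w c) x
        = dot (w a) (w c) * dot (w a) x + cross (w a) (w c) * cross (w a) x := by
      simp only [dot, cross]
      ring
    have hpos : 0 ≤ dot (w a) (w a) :=
      add_nonneg (mul_self_nonneg _) (mul_self_nonneg _)
    rw [h0, zero_mul, add_zero] at hid
    have h1 : 0 ≤ dot (w a) (w a) * dot (w c) x := mul_nonneg hpos (by linarith)
    have h2 : dot (w a) (w c) * dot (w a) x < 0 := mul_neg_of_neg_of_pos hneg (by linarith)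
    linarith
  · -- The cone spanned by the outer two vectors contains the last one instead.
    refine absurd (one_lt_dot_of_cross_pos (a := w c) (c := w a) (b := l) ?_ ?_ ?_ (hlt _ _ hcl)
      (hy _) (hlt _ _ hal) ht hr) (not_lt.2 hxl)
    · apply hcross
      rw [hθl]
      exact Real.sin_pos_of_pos_of_lt_pi (by linarith) (by linarith)
    · apply hcross
      rw [hθl, ← Real.sin_add_two_pi]
      exact Real.sin_pos_of_pos_of_lt_pi (by linarith) (by linarith)
    · apply hcross
      rw [← Real.sin_add_two_pi]
      exact Real.sin_pos_of_pos_of_lt_pi (by linarith) (by linarith)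

/-- The edges of a polygon can be numbered so that, among all but the last of them, those visible
from a point on the inner side of the last edge line are consecutive. -/
lemma IsFacetSystem.exists_order {P : Set Plane} {M : ℕ} {f : Fin (M + 1) → Plane →ₗ[ℝ] ℝ}
    {c : Fin (M + 1) → ℝ} (h : IsFacetSystem P f c) :
    ∃ σ : Equiv.Perm (Fin M), ∀ x, f (Fin.last M) x ≤ c (Fin.last M) → ∀ r s t, r < s → s < t →
      c (σ r).castSucc ≤ f (σ r).castSucc x → c (σ t).castSucc ≤ f (σ t).castSucc x →
        c (σ s).castSucc < f (σ s).castSucc x := by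
  obtain ⟨o, ho⟩ := h.inner
  choose y hy hlt using h.facet
  have hpos : ∀ j, 0 < c j - f j o := fun j => sub_pos.2 (ho j)
  -- Polar dual points with respect to the interior point `o`.
  set w : Fin (M + 1) → ℂ := fun j =>
    ⟨f j (Pi.single 0 1) / (c j - f j o), f j (Pi.single 1 1) / (c j - f j o)⟩ with hw
  set e : Plane → ℂ := fun x => ⟨x 0 - o 0, x 1 - o 1⟩ with he
  have hdot : ∀ j x, dot (w j) (e x) = (f j x - f j o) / (c j - f j o) := by
    intro j x
    have h1 : f j x - f j o = f j (Pi.single 0 1) * (x 0 - o 0)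
        + f j (Pi.single 1 1) * (x 1 - o 1) := by
      rw [apply_eq (f j) x, apply_eq (f j) o]
      ring
    rw [h1]
    simp only [dot, hw, he]
    ring
  obtain ⟨σ, hσ⟩ := exists_angular_order (w := w) (y := fun j => e (y j))
    (fun j => by rw [hdot, hy, div_self (hpos j).ne'])
    (fun i j hij => by
      rw [hdot, div_lt_one (hpos i)]
      linarith [hlt j i hij])
  refine ⟨σ, fun x hx r s t hrs hst hr ht => ?_⟩
  have key := hσ (e x)
  simp only [hdot, div_le_one (hpos _), one_le_div (hpos _), one_lt_div (hpos _),
    sub_le_sub_iff_right, sub_lt_sub_iff_right] at key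
  exact key hx r s t hrs hst hr ht

/-! ### Representations from words -/

/-- Products of slacks along a balanced word, together with the slack of one further edge, cut out
the polygon. At a point outside the polygon and on the inner side of the further edge line, the
violated constraints form a block, and so do they after adding any of the tight constraints. If no
product were negative, then every letter of odd multiplicity in the block would belong to a tight
constraint; adding one such constraint for each of these letters would make all multiplicities
even. -/
lemma succ_mem_closedCounts {M n k : ℕ} (hk : 1 ≤ k) (h : HasBalancedWord M n k) :
    n + 1 ∈ closedCounts (M + 1) k := by
  intro P hP
  obtain ⟨f, c, hfc⟩ := hP.exists_isFacetSystem
  obtain ⟨L, hLM, h_av, h_lt, h_count⟩ := h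
  obtain ⟨σ, hσ⟩ := hfc.exists_order
  set l : Fin M → MvPolynomial (Fin 2) ℝ :=
    fun r => slack (f (σ r).castSucc) (c (σ r).castSucc) with hl
  set A : ℕ → Finset (Fin M) := fun i => Finset.univ.filter fun r : Fin M => L[(r : ℕ)]? = some i
    with hA
  set p : Fin (n + 1) → MvPolynomial (Fin 2) ℝ :=
    Fin.lastCases (slack (f (Fin.last M)) (c (Fin.last M))) fun i => ∏ r ∈ A i, l r with hp
  have hp_last : p (Fin.last n) = slack (f (Fin.last M)) (c (Fin.last M)) := by simp [hp]
  have hp_cast : ∀ i : Fin n, p i.castSucc = ∏ r ∈ A i, l r := fun i => by simp [hp]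
  refine ⟨p, Set.Subset.antisymm ?_ ?_, ?_⟩
  · intro x hx i
    induction i using Fin.lastCases with
    | last => rw [hp_last]; exact (hfc.slack_factor _).2.1 x hx
    | cast i =>
      rw [hp_cast, map_prod]
      exact Finset.prod_nonneg fun r _ => (hfc.slack_factor _).2.1 x hx
  · intro x hx
    by_contra hxP
    have hlast : f (Fin.last M) x ≤ c (Fin.last M) := by
      have := hx (Fin.last n)
      rwa [hp_last, eval_slack, sub_nonneg] at this
    have hxσ := hσ x hlast
    set v : Fin M → ℝ := fun r => c (σ r).castSucc - f (σ r).castSucc x with hv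
    have hxv : ∀ r s t, r < s → s < t → v r ≤ 0 → v t ≤ 0 → v s < 0 := by
      intro r s t hrs hst hr ht
      exact sub_neg.2 (hxσ r s t hrs hst (sub_nonpos.1 hr) (sub_nonpos.1 ht))
    have hprod : ∀ i < n, 0 ≤ ∏ r ∈ A i, v r := by
      intro i hi
      have := hx (Fin.castSucc ⟨i, hi⟩)
      rw [hp_cast, map_prod] at this
      simpa [hl, hv] using this
    have hA_empty : ∀ i, n ≤ i → A i = ∅ := by
      intro i hi
      refine Finset.filter_eq_empty_iff.2 fun r _ hr => ?_
      exact absurd (h_lt i (List.mem_of_getElem? hr)) (not_lt.2 hi)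
    have hA_unique : ∀ {r i j}, r ∈ A i → r ∈ A j → i = j := by
      intro r i j hi hj
      simp only [hA, Finset.mem_filter, Finset.mem_univ, true_and] at hi hj
      exact Option.some_injective _ (hi.symm.trans hj)
    set neg : Finset (Fin M) := Finset.univ.filter fun r => v r < 0 with hneg
    have hneg_ne : neg.Nonempty := by
      by_contra hemp
      rw [Finset.not_nonempty_iff_eq_empty, hneg, Finset.filter_eq_empty_iff] at hemp
      refine hxP (hfc.mem_iff.2 fun j => ?_)
      induction j using Fin.lastCases with
      | last => exact hlast
      | cast j =>
        have := hemp (Finset.mem_univ (σ.symm j))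
        simpa [hv] using this
    have htight : ∀ i, Odd (neg.filter fun r => r ∈ A i).card → ∃ r ∈ A i, v r = 0 := by
      intro i hodd
      by_contra! hne
      have hi : i < n := by
        by_contra hi
        rw [hA_empty i (not_lt.1 hi)] at hodd
        simp at hodd
      refine absurd (hprod i hi) (not_le.2 ?_)
      have hfilter : (A i).filter (fun r => v r < 0) = neg.filter fun r => r ∈ A i := by
        ext r
        simp [hneg, and_comm]
      rw [← Finset.prod_filter_mul_prod_filter_not (A i) (fun r => v r < 0), hfilter]
      refine mul_neg_of_neg_of_pos ?_ (Finset.prod_pos fun r hr => ?_)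
      · have h1 : ∏ r ∈ neg.filter (fun r => r ∈ A i), v r
            = -∏ r ∈ neg.filter (fun r => r ∈ A i), -v r := by
          rw [Finset.prod_neg, hodd.neg_one_pow]
          ring
        rw [h1, neg_lt_zero]
        refine Finset.prod_pos fun r hr => ?_
        simpa [hneg] using (Finset.mem_filter.1 (Finset.mem_filter.1 hr).1).2
      · rw [Finset.mem_filter, not_lt] at hr
        exact lt_of_le_of_ne hr.2 (hne r hr.1).symm
    have : Nonempty (Fin M) := ⟨hneg_ne.choose⟩
    choose! τ hτA hτ0 using htight
    set Z : Finset (Fin M) :=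
      ((Finset.range n).filter fun i => Odd (neg.filter fun r => r ∈ A i).card).image τ with hZ
    have hZ0 : ∀ r ∈ Z, v r = 0 := by
      intro r hr
      obtain ⟨i, hi, rfl⟩ := Finset.mem_image.1 hr
      exact hτ0 i (Finset.mem_filter.1 hi).2
    have hle : ∀ r ∈ neg ∪ Z, v r ≤ 0 := by
      intro r hr
      rcases Finset.mem_union.1 hr with hr | hr
      · exact (Finset.mem_filter.1 hr).2.le
      · exact (hZ0 r hr).le
    have hconn : ((neg ∪ Z : Finset (Fin M)) : Set (Fin M)).OrdConnected := by
      refine ⟨fun r hr t ht s hs => ?_⟩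
      rcases hs.1.eq_or_lt with rfl | hrs
      · exact hr
      rcases hs.2.eq_or_lt with rfl | hst
      · exact ht
      have := hxv r s t hrs hst (hle r hr) (hle t ht)
      simp [hneg, this]
    obtain ⟨i, hi⟩ := h_av.exists_odd_card hLM (hneg_ne.mono Finset.subset_union_left) hconn
    have hi' : Odd ((neg ∪ Z).filter fun r => r ∈ A i).card := by simpa [hA] using hi
    have hdisj : Disjoint (neg.filter fun r => r ∈ A i) (Z.filter fun r => r ∈ A i) := by
      refine Finset.disjoint_left.2 fun r hr hr' => ?_
      have h1 := (Finset.mem_filter.1 (Finset.mem_filter.1 hr).1).2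
      rw [hZ0 r (Finset.mem_filter.1 hr').1] at h1
      exact lt_irrefl _ h1
    rw [Finset.filter_union, Finset.card_union_of_disjoint hdisj] at hi'
    by_cases hodd : Odd (neg.filter fun r => r ∈ A i).card
    · have hin : i < n := by
        by_contra hin
        exact Finset.notMem_empty _ (hA_empty i (not_lt.1 hin) ▸ hτA i hodd)
      have hZi : (Z.filter fun r => r ∈ A i) = {τ i} := by
        ext r
        rw [Finset.mem_filter, Finset.mem_singleton]
        constructor
        · rintro ⟨hr, hri⟩
          obtain ⟨j, hj, rfl⟩ := Finset.mem_image.1 hr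
          rw [hA_unique (hτA j (Finset.mem_filter.1 hj).2) hri]
        · rintro rfl
          exact ⟨Finset.mem_image.2 ⟨i, Finset.mem_filter.2 ⟨Finset.mem_range.2 hin, hodd⟩, rfl⟩,
            hτA i hodd⟩
      rw [hZi, Finset.card_singleton] at hi'
      exact Nat.not_even_iff_odd.2 hi' hodd.add_one
    · have hZi : (Z.filter fun r => r ∈ A i) = ∅ := by
        refine Finset.filter_eq_empty_iff.2 fun r hr hri => ?_
        obtain ⟨j, hj, rfl⟩ := Finset.mem_image.1 hr
        have hj' := (Finset.mem_filter.1 hj).2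
        exact hodd (hA_unique (hτA j hj') hri ▸ hj')
      rw [hZi, Finset.card_empty, add_zero] at hi'
      exact hodd hi'
  · intro i
    induction i using Fin.lastCases with
    | last =>
      refine ⟨{slack (f (Fin.last M)) (c (Fin.last M))}, by simpa using hk, by simp [hp_last], ?_⟩
      simpa using hfc.slack_factor (Fin.last M)
    | cast i =>
      refine ⟨(A i).val.map l, ?_, by rw [hp_cast]; rfl, ?_⟩
      · rw [Multiset.card_map, Finset.card_val]
        have h1 := count_drop_take L i 0 M (Nat.zero_le M) hLM.ge
        rw [List.drop_zero, ← hLM, List.take_length] at h1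
        refine le_trans (le_of_eq ?_) (h_count i)
        rw [h1, ← Finset.card_map Fin.valEmbedding]
        congr 1
        ext r
        simp only [hA, Finset.mem_map, Finset.mem_filter, Finset.mem_univ, true_and,
          Fin.valEmbedding_apply, Finset.mem_Ico]
        constructor
        · rintro ⟨r, hr, rfl⟩
          exact ⟨⟨Nat.zero_le _, hLM ▸ r.2⟩, hr⟩
        · rintro ⟨⟨_, h2⟩, h3⟩
          exact ⟨⟨r, hLM ▸ h2⟩, h3, rfl⟩
      · intro a ha
        obtain ⟨r, _, rfl⟩ := Multiset.mem_map.1 ha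
        exact hfc.slack_factor _

/-- In a closed representation, discard the products that vanish identically; the others are
positive in the interior. Conversely the strict inequalities define an open subset of `P`. -/
lemma closedCounts_subset_openCounts (m k : ℕ) : closedCounts m k ⊆ openCounts m k := by
  intro n hn P hP
  obtain ⟨p, hpP, hp⟩ := hn P hP
  obtain ⟨f, c, hfc⟩ := hP.exists_isFacetSystem
  have hone : IsEdgeProduct k P 1 := ⟨0, by simp, by simp, by simp⟩
  classical
  refine ⟨fun i => if p i = 0 then 1 else p i, Set.Subset.antisymm ?_ ?_, ?_⟩
  · intro x hx i
    simp only
    split_ifs with h0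
    · simp
    · obtain ⟨L, _, hL, hLa⟩ := hp i
      rw [hL, map_multiset_prod]
      refine Multiset.prod_pos fun b hb => ?_
      obtain ⟨a, ha, rfl⟩ := Multiset.mem_map.1 hb
      obtain ⟨ha1, ha2, I, hI, haI⟩ := hLa a ha
      obtain ⟨j, r, hr⟩ := hfc.exists_eval_eq_mul ha1 hI haI
      have hpos : 0 < c j - f j x := by
        rw [hfc.interior_eq] at hx
        exact sub_pos.2 (hx j)
      have h1 := ha2 x (interior_subset hx)
      refine lt_of_le_of_ne h1 fun he => h0 ?_
      rw [hr] at he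
      have hr0 : r = 0 := (mul_eq_zero.1 he.symm).resolve_right hpos.ne'
      have ha0 : a = 0 := MvPolynomial.funext fun z => by rw [hr, hr0, zero_mul, map_zero]
      rw [hL]
      exact Multiset.prod_eq_zero (ha0 ▸ ha)
  · refine interior_maximal ?_ ?_
    · intro x hx
      rw [hpP]
      intro i
      have := hx i
      simp only at this
      split_ifs at this with h0
      · simp [h0]
      · exact this.le
    · rw [Set.ofPred_forall]
      exact isOpen_iInter_of_finite fun i =>
        isOpen_lt continuous_const (MvPolynomial.continuous_eval _)
  · intro i
    simp only
    split_ifs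
    · exact hone
    · exact hp i

/-! ### The lower bound -/

/-- The tangent line of the parabola `y = x²` at `x = j` is `2 j x - y = j²`. -/
noncomputable def tangent (j : ℝ) : Plane →ₗ[ℝ] ℝ := (2 * j) • LinearMap.proj 0 - LinearMap.proj 1

lemma slack_tangent (j a b : ℝ) :
    j ^ 2 - tangent j ![(a + b) / 2, a * b] = (j - a) * (j - b) := by
  simp [tangent]
  ring

/-- The region above the tangent lines of the parabola `y = x²` at `0, …, m - 1`. -/
def parabolaPolygon (m : ℕ) : Set Plane := {x | ∀ j : Fin m, tangent (j : ℕ) x ≤ ((j : ℕ) : ℝ) ^ 2}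

lemma isFacetSystem_parabolaPolygon (m : ℕ) :
    IsFacetSystem (parabolaPolygon m) (fun j : Fin m => tangent (j : ℕ))
      fun j => ((j : ℕ) : ℝ) ^ 2 := by
  refine ⟨rfl, ⟨![(-1 + -1) / 2, -1 * -1], fun j => ?_⟩,
    fun j => ⟨![((j : ℕ) + (j : ℕ)) / 2, (j : ℕ) * (j : ℕ)], ?_, fun i hij => ?_⟩⟩
  · rw [← sub_pos, slack_tangent]
    exact mul_self_pos.2 (by rw [sub_neg_eq_add]; positivity)
  · rw [eq_comm, ← sub_eq_zero, slack_tangent]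
    ring
  · rw [← sub_pos, slack_tangent]
    have : ((i : ℕ) : ℝ) - (j : ℕ) ≠ 0 := by
      rw [sub_ne_zero, Ne, Nat.cast_inj]
      exact fun h => hij (Fin.ext h)
    exact mul_self_pos.2 this

lemma isPolygonWithEdges_parabolaPolygon (m : ℕ) : IsPolygonWithEdges m (parabolaPolygon m) := by
  refine ⟨(isFacetSystem_parabolaPolygon m).isPolygon, ?_⟩
  rw [(isFacetSystem_parabolaPolygon m).encard_edges, Nat.card_fin]

/-- On the relative interior of an edge some product has to vanish, and a factor that vanishes on
two edges vanishes on the polygon. -/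
lemma le_mul_of_mem_openCounts {m k n : ℕ} (hn : n ∈ openCounts m k) : m ≤ n * k := by
  obtain ⟨p, hpP, hp⟩ := hn _ (isPolygonWithEdges_parabolaPolygon m)
  have hfc := isFacetSystem_parabolaPolygon m
  set P := parabolaPolygon m
  choose L hLk hL hLa using hp
  choose y hyP hy hlt using hfc.exists_facet_mem
  have hvanish : ∀ j, ∃ i, ∃ a ∈ L i, MvPolynomial.eval (y j) a = 0 := by
    intro j
    by_contra! hne
    have hint : y j ∈ interior P := by
      rw [hpP]
      intro i
      rw [hL, map_multiset_prod]
      refine Multiset.prod_pos fun b hb => ?_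
      obtain ⟨a, ha, rfl⟩ := Multiset.mem_map.1 hb
      exact lt_of_le_of_ne ((hLa i a ha).2.1 _ (hyP j)) (hne i a ha).symm
    rw [hfc.interior_eq] at hint
    exact (hint j).ne (hy j)
  choose i a ha ha0 using hvanish
  obtain ⟨o, ho⟩ := hfc.interior_nonempty
  have hinj : Function.Injective fun j => (⟨i j, a j⟩ : Σ _ : Fin n, MvPolynomial (Fin 2) ℝ) := by
    intro j j' hjj
    by_contra hne
    obtain ⟨hi, haa⟩ := Sigma.mk.inj_iff.1 hjj
    have haa : a j = a j' := eq_of_heq haa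
    obtain ⟨ha1, -, I, hI, haI⟩ := hLa _ _ (ha j)
    obtain ⟨e, r, hr⟩ := hfc.exists_eval_eq_mul ha1 hI haI
    have hr0 : r = 0 := by
      by_contra hr0
      have h1 := ha0 j
      have h2 := ha0 j'
      rw [← haa] at h2
      rw [hr] at h1 h2
      have h3 := (mul_eq_zero.1 h1).resolve_left hr0
      have h4 := (mul_eq_zero.1 h2).resolve_left hr0
      by_cases hej : e = j
      · exact absurd (hlt j' e (fun h => hne (hej.symm.trans h))) (by linarith)
      · exact absurd (hlt j e hej) (by linarith)
    rw [hpP] at ho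
    have h5 := ho (i j)
    rw [hL, map_multiset_prod, Multiset.prod_eq_zero] at h5
    · exact lt_irrefl _ h5
    · exact Multiset.mem_map.2 ⟨a j, ha j, by rw [hr, hr0, zero_mul]⟩
  classical
  have hcard := Finset.card_le_card_of_injOn (s := Finset.univ)
    (t := Finset.univ.sigma fun i => (L i).toFinset) _
    (fun j _ => by simpa using ha j) hinj.injOn
  rw [Finset.card_univ, Fintype.card_fin, Finset.card_sigma] at hcard
  calc m ≤ ∑ i, (L i).toFinset.card := hcard
    _ ≤ ∑ _i : Fin n, k := Finset.sum_le_sum fun i _ => (L i).toFinset_card_le.trans (hLk i)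
    _ = n * k := by simp

/-- For `a < b` there is a point below exactly the tangents at `a, …, b - 1`. The sign of an edge
product there is the product of its signs at the points below exactly the first `a`, respectively
`b`, tangents, so no two of the latter points have the same sign vector. -/
lemma succ_le_two_pow_of_mem_openCounts {m k n : ℕ} (hn : n ∈ openCounts m k) :
    m + 1 ≤ 2 ^ n := by
  obtain ⟨p, hpP, hp⟩ := hn _ (isPolygonWithEdges_parabolaPolygon m)
  have hfc := isFacetSystem_parabolaPolygon m
  set P := parabolaPolygon m
  have hp0 : ∀ i, p i ≠ 0 := by
    intro i h0
    obtain ⟨o, ho⟩ := hfc.interior_nonempty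
    rw [hpP] at ho
    have := ho i
    rw [h0, map_zero] at this
    exact lt_irrefl _ this
  choose L hLk hL hLa using hp
  set X : ℕ → ℕ → Plane := fun a b =>
    ![(((a : ℝ) - 1 / 2) + ((b : ℝ) - 1 / 2)) / 2, ((a : ℝ) - 1 / 2) * ((b : ℝ) - 1 / 2)] with hX
  have hhalf : ∀ a b : ℕ, (a : ℝ) - ((b : ℝ) - 1 / 2) ≠ 0 := by
    intro a b h0
    have h1 : (2 * a + 1 : ℝ) = 2 * b := by linarith
    have h2 : 2 * a + 1 = 2 * b := by exact_mod_cast h1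
    omega
  have hfactor : ∀ i, ∀ q ∈ L i, ∃ (j : ℕ) (r : ℝ), 0 < r ∧ ∀ a b, MvPolynomial.eval (X a b) q
      = r * (((j : ℝ) - ((a : ℝ) - 1 / 2)) * ((j : ℝ) - ((b : ℝ) - 1 / 2))) := by
    intro i q hq
    obtain ⟨hq1, hq2, I, hI, hqI⟩ := hLa i q hq
    obtain ⟨j, r, hr⟩ := hfc.exists_eval_eq_mul hq1 hI hqI
    refine ⟨j, r, ?_, fun a b => by rw [hr, hX, slack_tangent]⟩
    obtain ⟨o, ho⟩ := hfc.inner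
    have h1 := hq2 o (hfc.mem_iff.2 fun j => (ho j).le)
    rw [hr] at h1
    refine lt_of_le_of_ne (nonneg_of_mul_nonneg_left h1 (sub_pos.2 (ho j))) ?_
    rintro rfl
    refine hp0 i ?_
    rw [hL]
    have : q = 0 := MvPolynomial.funext fun z => by rw [hr, zero_mul, map_zero]
    exact Multiset.prod_eq_zero (this ▸ hq)
  have hsign : ∀ i a b, 0 < MvPolynomial.eval (X 0 a) (p i) * MvPolynomial.eval (X 0 b) (p i) *
      MvPolynomial.eval (X a b) (p i) := by
    intro i a b
    rw [hL, map_multiset_prod, map_multiset_prod, map_multiset_prod, ← Multiset.prod_map_mul,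
      ← Multiset.prod_map_mul]
    refine Multiset.prod_pos fun t ht => ?_
    obtain ⟨q, hq, rfl⟩ := Multiset.mem_map.1 ht
    obtain ⟨j, r, hr0, hr⟩ := hfactor i q hq
    rw [hr, hr, hr]
    have h0 := hhalf j 0
    have ha := hhalf j a
    have hb := hhalf j b
    calc (0 : ℝ) < r ^ 3 * ((j - ((0 : ℕ) - 1 / 2)) * (j - (a - 1 / 2)) * (j - (b - 1 / 2))) ^ 2 :=
        mul_pos (pow_pos hr0 3) (sq_pos_of_ne_zero (mul_ne_zero (mul_ne_zero h0 ha) hb))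
      _ = _ := by ring
  have hinj : Function.Injective fun (t : Fin (m + 1)) (i : Fin n) =>
      decide (0 < MvPolynomial.eval (X 0 t) (p i)) := by
    have hlt : ∀ a b : Fin (m + 1), a < b →
        (fun i : Fin n => decide (0 < MvPolynomial.eval (X 0 a) (p i)))
          ≠ fun i => decide (0 < MvPolynomial.eval (X 0 b) (p i)) := by
      intro a b hab heq
      have hmem : X a b ∈ interior P := by
        rw [hpP]
        intro i
        have h1 := hsign i a b
        have h2 := congrFun heq i
        rw [decide_eq_decide] at h2
        refine pos_of_mul_pos_right h1 ?_
        rcases lt_or_ge 0 (MvPolynomial.eval (X 0 a) (p i)) with h3 | h3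
        · exact (mul_pos h3 (h2.1 h3)).le
        · exact mul_nonneg_of_nonpos_of_nonpos h3 (not_lt.1 fun h => absurd (h2.2 h) (not_lt.2 h3))
      rw [hfc.interior_eq] at hmem
      have h4 := sub_pos.2 (hmem ⟨a, by omega⟩)
      simp only [hX] at h4
      rw [slack_tangent] at h4
      have h5 : ((a : ℕ) : ℝ) + 1 ≤ (b : ℕ) := by exact_mod_cast hab
      nlinarith
    intro a b hab
    rcases lt_trichotomy a b with h | h | h
    · exact absurd hab (hlt a b h)
    · exact h
    · exact absurd hab.symm (hlt b a h)
  have := Fintype.card_le_of_injective _ hinj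
  simpa using this

lemma s_le_of_mem_openCounts {m k n : ℕ} (hm : 1 ≤ m) (hk : 1 ≤ k) (hn : n ∈ openCounts m k) :
    s m k ≤ n := by
  refine max_le ?_ ?_
  · rw [div_le_iff₀ (by exact_mod_cast hk)]
    exact_mod_cast le_mul_of_mem_openCounts hn
  · rw [Real.logb_le_iff_le_rpow one_lt_two (by exact_mod_cast hm), Real.rpow_natCast]
    exact_mod_cast (Nat.le_succ m).trans (succ_le_two_pow_of_mem_openCounts hn)

/-! ### The upper bound -/

lemma mem_closedCounts_self {m k : ℕ} (hm : 1 ≤ m) (hk : 1 ≤ k) : m ∈ closedCounts m k := by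
  obtain ⟨M, rfl⟩ : ∃ M, m = M + 1 := ⟨m - 1, by omega⟩
  exact succ_mem_closedCounts hk (hasBalancedWord_self M hk)

lemma closedN_le_of_hasBalancedWord {m n k : ℕ} (hm : 1 ≤ m) (hk : 1 ≤ k)
    (h : HasBalancedWord (m - 1) n k) : closedN m k ≤ n + 1 := by
  obtain ⟨M, rfl⟩ : ∃ M, m = M + 1 := ⟨m - 1, by omega⟩
  exact Nat.sInf_le (succ_mem_closedCounts hk h)

lemma clog_two_le (n : ℕ) (hn : 1 ≤ n) : (Nat.clog 2 n : ℝ) ≤ Real.logb 2 n + 1 := by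
  have h := Real.natCeil_logb_natCast 2 n
  rw [← show ((2 : ℕ) : ℝ) = 2 by norm_num, ← h]
  refine (Nat.ceil_lt_add_one (Real.logb_nonneg ?_ ?_)).le
  · norm_num
  · exact_mod_cast hn

/-- For `k < √m` the passes cost `log₂ k`, which is small compared with `m / k > √m`. -/
lemma closedN_le_of_sq_lt {m k : ℕ} (hk : 1 ≤ k) (hkm : k * k < m) :
    (closedN m k : ℝ) ≤ (m : ℝ) / k + (Real.logb 2 m + 3) := by
  have hk' : (0 : ℝ) < k := by exact_mod_cast hk
  have hkm' : k ≤ m := (Nat.le_mul_self k).trans hkm.le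
  have hword : HasBalancedWord (m - 1) (⌈(m : ℝ) / k⌉₊ + Nat.clog 2 k) k := by
    refine hasBalancedWord_passes hk ?_ (Nat.le_pow_clog one_lt_two k)
    have := Nat.le_ceil ((m : ℝ) / k)
    rw [div_le_iff₀ hk'] at this
    rw [mul_comm]
    exact (Nat.sub_le m 1).trans (by exact_mod_cast this)
  have h1 := closedN_le_of_hasBalancedWord (by omega) hk hword
  have h2 : (closedN m k : ℝ) ≤ ⌈(m : ℝ) / k⌉₊ + Nat.clog 2 k + 1 := by exact_mod_cast h1
  have h3 := (Nat.ceil_lt_add_one (show (0 : ℝ) ≤ (m : ℝ) / k by positivity)).le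
  have h4 := clog_two_le k hk
  have h5 : Real.logb 2 k ≤ Real.logb 2 m :=
    Real.logb_le_logb_of_le one_lt_two hk' (by exact_mod_cast hkm')
  linarith

lemma sq_le_two_pow_succ (k : ℕ) : k * k ≤ 2 ^ (k + 1) := by
  induction k with
  | zero => simp
  | succ k ih =>
    have := Nat.lt_two_pow_self (n := k)
    rw [pow_succ] at ih
    rw [pow_succ, pow_succ]
    nlinarith

/-- For `k ≥ √m` the number of rotated Gray codes is about `s = s m k`, so that numbering them costs
only `log₂ s`. -/
lemma closedN_le_of_le_sq {m k : ℕ} (hm : 2 ≤ m) (hk : 1 ≤ k) (hkm : m ≤ k * k) :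
    (closedN m k : ℝ) ≤ s m k + (Real.logb 2 (s m k + 1) + 3) := by
  have hk' : (0 : ℝ) < k := by exact_mod_cast hk
  set N := max ⌈(m : ℝ) / k⌉₊ (Nat.clog 2 m) with hN
  have hN1 : 1 ≤ N := le_trans (Nat.clog_pos one_lt_two hm) (le_max_right _ _)
  have hmN : m ≤ N * k := by
    have h1 := Nat.le_ceil ((m : ℝ) / k)
    rw [div_le_iff₀ hk'] at h1
    have h2 : m ≤ ⌈(m : ℝ) / k⌉₊ * k := by exact_mod_cast h1
    exact h2.trans (Nat.mul_le_mul_right k (le_max_left _ _))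
  have hm2 : m ≤ 2 ^ N := (Nat.le_pow_clog one_lt_two m).trans
    (Nat.pow_le_pow_right two_pos (le_max_right _ _))
  have hNk : N ≤ k + 1 := by
    refine max_le ?_ ?_
    · refine (Nat.ceil_le.2 ?_).trans k.le_succ
      rw [div_le_iff₀ hk']
      exact_mod_cast hkm
    · exact Nat.clog_le_of_le_pow (hkm.trans (sq_le_two_pow_succ k))
  have hword : HasBalancedWord (m - 1) (N + Nat.clog 2 N) k := by
    refine hasBalancedWord_rotations (K := min k (2 ^ N - 1)) hN1 ?_ (min_le_left _ _) hNk ?_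
      (Nat.le_pow_clog one_lt_two N)
    · exact (min_le_right _ _).trans_lt (Nat.sub_lt (by positivity) one_pos)
    · rcases min_choice k (2 ^ N - 1) with h | h
      · rw [h]
        omega
      · rw [h]
        exact (Nat.sub_le_sub_right hm2 1).trans (Nat.le_mul_of_pos_left _ hN1)
  have h1 := closedN_le_of_hasBalancedWord (by omega) hk hword
  have h2 : (closedN m k : ℝ) ≤ N + Nat.clog 2 N + 1 := by exact_mod_cast h1
  have h3 : (N : ℝ) ≤ s m k + 1 := by
    rw [hN, Nat.cast_max]
    refine max_le ?_ ?_
    · exact (Nat.ceil_lt_add_one (by positivity)).le.trans (by simp [s])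
    · exact (clog_two_le m (by omega)).trans (by simp [s])
  have h4 := clog_two_le N hN1
  have h5 : Real.logb 2 N ≤ Real.logb 2 (s m k + 1) :=
    Real.logb_le_logb_of_le one_lt_two (by exact_mod_cast hN1) h3
  linarith

/-- The relative error of the upper bound. -/
noncomputable def relError (m : ℕ) : ℝ :=
  (Real.logb 2 m + 3) / √m + (3 / Real.logb 2 m + 4 / √(Real.logb 2 m))

lemma tendsto_relError : Tendsto relError atTop (𝓝 0) := by
  unfold relError
  have hlog : Tendsto (fun m : ℕ => Real.logb 2 m) atTop atTop :=
    (Real.tendsto_logb_atTop one_lt_two).comp tendsto_natCast_atTop_atTop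
  have hsqrt : Tendsto (fun m : ℕ => √(m : ℝ)) atTop atTop :=
    Real.tendsto_sqrt_atTop.comp tendsto_natCast_atTop_atTop
  have h1 : Tendsto (fun m : ℕ => (Real.logb 2 m + 3) / √m) atTop (𝓝 0) := by
    have h : Tendsto (fun x : ℝ => Real.log x / x ^ (1 / 2 : ℝ)) atTop (𝓝 0) :=
      (isLittleO_log_rpow_atTop (by norm_num)).tendsto_div_nhds_zero
    have h' := ((h.comp (tendsto_natCast_atTop_atTop (R := ℝ))).const_mul (Real.log 2)⁻¹).add
      (hsqrt.const_div_atTop 3)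
    rw [mul_zero, add_zero] at h'
    refine h'.congr fun m => ?_
    simp only [Function.comp, Real.logb, Real.sqrt_eq_rpow]
    ring
  have h2 := (hlog.const_div_atTop 3).add ((Real.tendsto_sqrt_atTop.comp hlog).const_div_atTop 4)
  simpa using h1.add h2

lemma logb_two_add_one_le {x : ℝ} (hx : 0 ≤ x) : Real.logb 2 (x + 1) ≤ 4 * √x := by
  have h1 : Real.log (x + 1) ≤ 2 * √x := by
    have h2 : √(x + 1) ≤ √x + 1 := by
      rw [Real.sqrt_le_left (by positivity), add_sq, Real.sq_sqrt hx]
      linarith [Real.sqrt_nonneg x]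
    have h3 := Real.log_le_sub_one_of_pos (Real.sqrt_pos.2 (by linarith : 0 < x + 1))
    rw [Real.log_sqrt (by linarith)] at h3
    linarith
  rw [Real.logb, div_le_iff₀ (Real.log_pos one_lt_two)]
  nlinarith [Real.log_two_gt_d9, Real.sqrt_nonneg x]

lemma closedN_le {m k : ℕ} (hm : 2 ≤ m) (hk : 1 ≤ k) :
    (closedN m k : ℝ) ≤ (1 + relError m) * s m k := by
  have hm' : (2 : ℝ) ≤ m := by exact_mod_cast hm
  have hk' : (0 : ℝ) < k := by exact_mod_cast hk
  have hlog : 1 ≤ Real.logb 2 m := by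
    rw [Real.le_logb_iff_rpow_le one_lt_two (by linarith), Real.rpow_one]
    exact hm'
  have hs_log : Real.logb 2 m ≤ s m k := le_max_right _ _
  have hs : 1 ≤ s m k := hlog.trans hs_log
  have hsqrt : 0 < √(m : ℝ) := Real.sqrt_pos.2 (by linarith)
  have hA : 0 ≤ (Real.logb 2 m + 3) / √(m : ℝ) := by positivity
  have hB : 0 ≤ 3 / Real.logb 2 m + 4 / √(Real.logb 2 m) := by positivity
  rcases lt_or_ge (k * k) m with hkm | hkm
  · have h1 := closedN_le_of_sq_lt hk hkm
    have hs_div : (m : ℝ) / k ≤ s m k := le_max_left _ _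
    have h2 : √(m : ℝ) ≤ s m k := by
      refine le_trans ?_ hs_div
      rw [le_div_iff₀ hk']
      have hkm' : (k : ℝ) * k ≤ m := by exact_mod_cast hkm.le
      have h3 : (k : ℝ) ≤ √(m : ℝ) := Real.le_sqrt_of_sq_le (by rwa [sq])
      calc √(m : ℝ) * k ≤ √(m : ℝ) * √(m : ℝ) := by gcongr
        _ = m := Real.mul_self_sqrt (by linarith)
    have h3 : Real.logb 2 m + 3 ≤ (Real.logb 2 m + 3) / √(m : ℝ) * s m k := by
      rw [div_mul_eq_mul_div, le_div_iff₀ hsqrt]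
      gcongr
    have h4 := mul_nonneg hB (zero_le_one.trans hs)
    rw [relError]
    linarith
  · have h1 := closedN_le_of_le_sq hm hk hkm
    have h2 := logb_two_add_one_le (zero_le_one.trans hs)
    have h3 : 3 ≤ 3 / Real.logb 2 m * s m k := by
      rw [div_mul_eq_mul_div, le_div_iff₀ (by linarith)]
      gcongr
    have h4 : 4 * √(s m k) ≤ 4 / √(Real.logb 2 m) * s m k := by
      rw [div_mul_eq_mul_div, le_div_iff₀ (Real.sqrt_pos.2 (by linarith)), mul_assoc]
      gcongr
      calc √(s m k) * √(Real.logb 2 m) ≤ √(s m k) * √(s m k) := by gcongr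
        _ = s m k := Real.mul_self_sqrt (by linarith)
    have h5 := mul_nonneg hA (zero_le_one.trans hs)
    rw [relError]
    linarith

end PolygonRep

theorem theorem1p2 :
    (∀ m k : ℕ, 1 ≤ m → 1 ≤ k →
      IsLeast (PolygonRep.openCounts m k) (PolygonRep.openN m k) ∧
      IsLeast (PolygonRep.closedCounts m k) (PolygonRep.closedN m k) ∧
      PolygonRep.s m k ≤ (PolygonRep.openN m k : ℝ) ∧
      PolygonRep.openN m k ≤ PolygonRep.closedN m k) ∧
    ∃ ε : ℕ → ℝ, Tendsto ε atTop (𝓝 0) ∧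
      ∀ m k : ℕ, 2 ≤ m → 1 ≤ k →
        (PolygonRep.closedN m k : ℝ) ≤ (1 + ε m) * PolygonRep.s m k := by
  refine ⟨fun m k hm hk => ?_, PolygonRep.relError, PolygonRep.tendsto_relError,
    fun m k hm hk => PolygonRep.closedN_le hm hk⟩
  have hclosed := Nat.sInf_mem ⟨m, PolygonRep.mem_closedCounts_self hm hk⟩
  have hsub := PolygonRep.closedCounts_subset_openCounts m k
  have hopen := Nat.sInf_mem ⟨_, hsub hclosed⟩
  exact ⟨⟨hopen, fun n hn => Nat.sInf_le hn⟩, ⟨hclosed, fun n hn => Nat.sInf_le hn⟩,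
    PolygonRep.s_le_of_mem_openCounts hm hk hopen, Nat.sInf_le (hsub hclosed)⟩
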